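/- Let $k$ be a field with an endomorphism $\sigma\colon k\to k$. A $k$-$\sigma$-algebra is a commutative $k$-algebra $R$ with a ring endomorphism $\sigma\colon R\to R$ extending $\sigma\colon k\to k$. By an algebraic group over $k$ we mean an affine group scheme of finite type over $k$. For an algebraic group $\mathcal{G}$ over $k$ let $[\sigma]_k\mathcal{G}$ denote the functor $R\mapsto\mathcal{G}(R)$ from $k$-$\sigma$-algebras to groups. It is represented by the $k$-$\sigma$-algebra $k\{\mathcal{G}\}=\bigcup_{i\ge 0}k[\mathcal{G}[i]]$, where $\mathcal{G}[i]=\mathcal{G}\times{}^{\sigma}\mathcal{G}\times\cdots\times{}^{\sigma^i}\mathcal{G}$ and ${}^{\sigma^j}\mathcal{G}$ is the base change of $\mathcal{G}$ along $\sigma^j\colon k\to k$; the subring $k[\mathcal{G}[i]]$ is generated as a $k$-algebra by the elements $\sigma^j(a)$ with $a\in k[\mathcal{G}]$ and $0\le j\le i$. A $\sigma$-closed subgroup $G\le\mathcal{G}$ consists of subgroups $G(R)\le\mathcal{G}(R)$, for all $k$-$\sigma$-algebras $R$, that are the common zero sets of one set $F\subset k\{\mathcal{G}\}$. Let $\mathbb{I}(G)\subset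 k\{\mathcal{G}\}$ be the ideal of all $f$ that vanish on $G(R)$ for every $R$. For $i\ge 0$ the $i$-th order Zariski closure $G[i]$ of $G$ in $\mathcal{G}$ is the closed subscheme of $\mathcal{G}[i]$ defined by the ideal $\mathbb{I}(G)\cap k[\mathcal{G}[i]]$ of $k[\mathcal{G}[i]]$. A $\sigma$-algebraic group over $k$ is a functor from $k$-$\sigma$-algebras to groups that is representable by a finitely $\sigma$-generated $k$-$\sigma$-algebra. A $\sigma$-closed embedding of a $\sigma$-algebraic group $G$ into $\mathcal{G}$ is a morphism of group functors $G\to[\sigma]_k\mathcal{G}$ that is an isomorphism onto a $\sigma$-closed subgroup of $\mathcal{G}$; by the Zariski closures of $G$ in $\mathcal{G}$ we then mean those of this subgroup. **Theorem.** (1) Let $\mathcal{G}$ be an algebraic group over $k$ and let $G\le\mathcal{G}$ be a $\sigma$-closed subgroup. Then there exist integers $d,e\ge 0$ such that $$\dim(G[i])=d(i+1)+e\quad\text{for all sufficiently large } i.$$ (2) The integer $d$ depends only on the $\sigma$-algebraic group $G$, and not on the choice of $\mathcal{G}$ and of the $\sigma$-closed embedding $G\hookrightarrow\mathcal{G}$.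 If $d=0$, then also $e$ depends only on $G$, and not on the choice of $\mathcal{G}$ and of the $\sigma$-closed embedding $G\hookrightarrow\mathcal{G}$. -/

import Mathlib

open CategoryTheory

universe u

/-- A `k`-`σ`-algebra over the difference field `(k, σ)`: a commutative `k`-algebra `R` with a ring
endomorphism (not assumed to be injective) extending `σ : k → k`. -/
structure DiffAlg {k : Type u} [Field k] (σ : k →+* k) where
  carrier : Type u
  [commRing : CommRing carrier]
  [algebra : Algebra k carrier]
  /-- The endomorphism of the `k`-`σ`-algebra. -/
  sigma : carrier →+* carrier
  sigma_algebraMap : ∀ c : k, sigma (algebraMap k carrier c) = algebraMap k carrier (σ c)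

attribute [instance] DiffAlg.commRing DiffAlg.algebra

namespace DiffAlg

variable {k : Type u} [Field k] {σ : k →+* k}

/-- A morphism of `k`-`σ`-algebras: a `k`-algebra morphism commuting with `σ`. -/
@[ext]
structure Hom (R S : DiffAlg σ) where
  toAlgHom : R.carrier →ₐ[k] S.carrier
  map_sigma : ∀ r : R.carrier, toAlgHom (R.sigma r) = S.sigma (toAlgHom r)

/-- The category of `k`-`σ`-algebras. -/
instance : Category (DiffAlg σ) where
  Hom R S := Hom R S
  id R := ⟨AlgHom.id k R.carrier, fun _ => rfl⟩
  comp f g := ⟨g.toAlgHom.comp f.toAlgHom, fun r => by simp [f.map_sigma, g.map_sigma]⟩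

/-- The `k`-algebra morphism underlying a morphism of `k`-`σ`-algebras. -/
def algHom {R S : DiffAlg σ} (f : R ⟶ S) : R.carrier →ₐ[k] S.carrier :=
  Hom.toAlgHom f

/-- `R` is finitely `σ`-generated over `k`: there is a finite set `S` such that the elements
`σⁱ(s)`, for `s ∈ S` and `i ≥ 0`, generate `R` as a `k`-algebra. -/
def IsFinitelySigmaGenerated (R : DiffAlg σ) : Prop :=
  ∃ S : Finset R.carrier,
    Algebra.adjoin k {r : R.carrier | ∃ i : ℕ, ∃ s ∈ S, r = (R.sigma)^[i] s} = ⊤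

theorem iterate_sigma_algebraMap (R : DiffAlg σ) (i : ℕ) (c : k) :
    (R.sigma)^[i] (algebraMap k R.carrier c) = algebraMap k R.carrier (σ^[i] c) := by
  induction i with
  | zero => rfl
  | succ i ih => rw [Function.iterate_succ_apply', ih, R.sigma_algebraMap,
      Function.iterate_succ_apply']

end DiffAlg

/-! ### The `k`-`σ`-algebra `[σ]_k A` -/

namespace SigmaEnvelope

variable {k : Type u} [Field k] (σ : k →+* k) (A : Type u) [CommRing A] [Algebra k A]

/-- The relations between the generators `X (i, a)`, which stand for `σⁱ(a)`: for every `i`, the map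
`a ↦ X (i, a)` is additive and multiplicative, and it is `σⁱ` on the constants. -/
def relations : Set (MvPolynomial (ℕ × A) k) :=
  {p | ∃ (i : ℕ) (a b : A),
      p = MvPolynomial.X (i, a + b) - (MvPolynomial.X (i, a) + MvPolynomial.X (i, b))} ∪
  {p | ∃ (i : ℕ) (a b : A),
      p = MvPolynomial.X (i, a * b) - MvPolynomial.X (i, a) * MvPolynomial.X (i, b)} ∪
  {p | ∃ (i : ℕ) (c : k),
      p = MvPolynomial.X (i, algebraMap k A c) - MvPolynomial.C (σ^[i] c)}

/-- The ring underlying `[σ]_k A`, the union of the rings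
`A ⊗ (^σ A) ⊗ ⋯ ⊗ (^{σ^i} A)` over all `i`, given by generators and relations. -/
abbrev Ring : Type u := MvPolynomial (ℕ × A) k ⧸ Ideal.span (relations σ A)

/-- `X (i, a) ↦ X (i + 1, a)`, and `σ` on coefficients. -/
noncomputable def preSigma : MvPolynomial (ℕ × A) k →+* MvPolynomial (ℕ × A) k :=
  MvPolynomial.eval₂Hom (MvPolynomial.C.comp σ) fun p => MvPolynomial.X (p.1 + 1, p.2)

theorem preSigma_le :
    Ideal.span (relations σ A) ≤ (Ideal.span (relations σ A)).comap (preSigma σ A) := by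
  rw [Ideal.span_le]
  rintro p ((⟨i, a, b, rfl⟩ | ⟨i, a, b, rfl⟩) | ⟨i, c, rfl⟩) <;>
    refine Ideal.subset_span ?_
  · exact Or.inl (Or.inl ⟨i + 1, a, b, by simp [preSigma]⟩)
  · exact Or.inl (Or.inr ⟨i + 1, a, b, by simp [preSigma]⟩)
  · exact Or.inr ⟨i + 1, c, by simp [preSigma, ← Function.iterate_succ_apply']⟩

/-- The `k`-`σ`-algebra `[σ]_k A`. If `A = k[𝒢]`, this is `k{𝒢}`. -/
noncomputable abbrev diffAlg : DiffAlg σ where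
  carrier := Ring σ A
  sigma := Ideal.quotientMap _ (preSigma σ A) (preSigma_le σ A)
  sigma_algebraMap c := by
    change Ideal.quotientMap _ (preSigma σ A) (preSigma_le σ A)
      (Ideal.Quotient.mk _ (MvPolynomial.C c)) = Ideal.Quotient.mk _ (MvPolynomial.C (σ c))
    rw [Ideal.quotientMap_mk]
    simp [preSigma]

/-- The element `σⁱ(a)` of `[σ]_k A`. -/
noncomputable def gen (i : ℕ) (a : A) : (diffAlg σ A).carrier :=
  Ideal.Quotient.mk (Ideal.span (relations σ A)) (MvPolynomial.X (i, a))

/-- The canonical `k`-algebra morphism `A → [σ]_k A`. -/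
noncomputable def incl : A →ₐ[k] (diffAlg σ A).carrier where
  toFun := gen σ A 0
  map_add' a b := by
    refine Ideal.Quotient.eq.2 (Ideal.subset_span (Or.inl (Or.inl ⟨0, a, b, rfl⟩)))
  map_mul' a b := by
    refine Ideal.Quotient.eq.2 (Ideal.subset_span (Or.inl (Or.inr ⟨0, a, b, rfl⟩)))
  map_one' := by
    refine Ideal.Quotient.eq.2 (Ideal.subset_span (Or.inr ⟨0, 1, by simp⟩))
  map_zero' := by
    have h : gen σ A 0 (algebraMap k A 0) = algebraMap k (diffAlg σ A).carrier 0 :=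
      Ideal.Quotient.eq.2 (Ideal.subset_span (Or.inr ⟨0, 0, rfl⟩))
    simpa using h
  commutes' c := by
    refine Ideal.Quotient.eq.2 (Ideal.subset_span (Or.inr ⟨0, c, rfl⟩))

theorem sigma_gen (i : ℕ) (a : A) :
    (diffAlg σ A).sigma (gen σ A i a) = gen σ A (i + 1) a := by
  change Ideal.quotientMap _ (preSigma σ A) (preSigma_le σ A) (Ideal.Quotient.mk _ _) = _
  rw [Ideal.quotientMap_mk]
  simp [preSigma, gen]

variable {σ A}

/-- The evaluation `[σ]_k A → R`, `σⁱ(a) ↦ σⁱ(g(a))`, attached to a `k`-algebra morphism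
`g : A → R` into a `k`-`σ`-algebra `R`. -/
noncomputable def eval {R : DiffAlg σ} (g : A →ₐ[k] R.carrier) :
    (diffAlg σ A).carrier →ₐ[k] R.carrier :=
  Ideal.Quotient.liftₐ (Ideal.span (relations σ A))
    (MvPolynomial.aeval fun p : ℕ × A => (R.sigma)^[p.1] (g p.2)) (by
      suffices h : Ideal.span (relations σ A) ≤ RingHom.ker
          (MvPolynomial.aeval (R := k) fun p : ℕ × A => (R.sigma)^[p.1] (g p.2)) from
        fun a ha => h ha
      rw [Ideal.span_le]
      rintro p ((⟨i, a, b, rfl⟩ | ⟨i, a, b, rfl⟩) | ⟨i, c, rfl⟩)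
      · simp [RingHom.mem_ker, iterate_map_add]
      · simp [RingHom.mem_ker, iterate_map_mul]
      · simp [RingHom.mem_ker, DiffAlg.iterate_sigma_algebraMap])

theorem eval_gen {R : DiffAlg σ} (g : A →ₐ[k] R.carrier) (i : ℕ) (a : A) :
    eval g (gen σ A i a) = (R.sigma)^[i] (g a) := by
  change Ideal.Quotient.liftₐ (Ideal.span (relations σ A)) _ _ (Ideal.Quotient.mk _ _) = _
  exact (MvPolynomial.aeval_X _ _)

theorem eval_sigma {R : DiffAlg σ} (g : A →ₐ[k] R.carrier) (f : (diffAlg σ A).carrier) :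
    eval g ((diffAlg σ A).sigma f) = R.sigma (eval g f) := by
  suffices h : ((eval g).toRingHom.comp (diffAlg σ A).sigma).comp
        (Ideal.Quotient.mk (Ideal.span (relations σ A))) =
      (R.sigma.comp (eval g).toRingHom).comp
        (Ideal.Quotient.mk (Ideal.span (relations σ A))) by
    obtain ⟨p, rfl⟩ := Ideal.Quotient.mk_surjective f
    exact congrArg (fun φ => φ p) h
  apply MvPolynomial.ringHom_ext
  · intro c
    change eval g ((diffAlg σ A).sigma (algebraMap k (diffAlg σ A).carrier c)) =
      R.sigma (eval g (algebraMap k (diffAlg σ A).carrier c))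
    rw [DiffAlg.sigma_algebraMap, AlgHom.commutes, AlgHom.commutes, DiffAlg.sigma_algebraMap]
  · rintro ⟨i, a⟩
    change eval g ((diffAlg σ A).sigma (gen σ A i a)) = R.sigma (eval g (gen σ A i a))
    rw [sigma_gen, eval_gen, eval_gen, Function.iterate_succ_apply']

/-- The universal property of `[σ]_k A`: every `k`-algebra morphism from `A` to a `k`-`σ`-algebra
extends uniquely to a morphism of `k`-`σ`-algebras on `[σ]_k A`. -/
theorem existsUnique_hom {R : DiffAlg σ} (g : A →ₐ[k] R.carrier) :
    ∃! φ : diffAlg σ A ⟶ R, ∀ a : A, DiffAlg.algHom φ (incl σ A a) = g a := by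
  refine ⟨⟨eval g, eval_sigma g⟩, fun a => eval_gen g 0 a, fun φ hφ => ?_⟩
  have hi : ∀ (i : ℕ) (a : A),
      DiffAlg.Hom.toAlgHom φ (gen σ A i a) = (R.sigma)^[i] (g a) := by
    intro i a
    induction i with
    | zero => exact hφ a
    | succ i ih =>
      rw [← sigma_gen, DiffAlg.Hom.map_sigma, ih, Function.iterate_succ_apply']
  refine DiffAlg.Hom.ext (Ideal.Quotient.algHom_ext k (MvPolynomial.algHom_ext fun p => ?_))
  exact (hi p.1 p.2).trans (eval_gen g p.1 p.2).symm

variable (σ A)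

/-- `k[𝒢[i]]` inside `k{𝒢}`, for `A = k[𝒢]`: the `k`-subalgebra
`A ⊗ (^σ A) ⊗ ⋯ ⊗ (^{σ^i} A)` of `[σ]_k A`, which is generated by the `σʲ(a)` with `j ≤ i`. -/
noncomputable def orderLE (i : ℕ) : Subalgebra k (diffAlg σ A).carrier :=
  Algebra.adjoin k {f | ∃ j ≤ i, ∃ a : A, f = gen σ A j a}

end SigmaEnvelope

/-! ### Algebraic groups as `σ`-algebraic groups

An algebraic group `𝒢` over `k` (an affine group scheme of finite type) is given by its coordinate
ring `A = k[𝒢]`, a commutative Hopf algebra over `k` of finite type; its group of points in a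
`k`-algebra `R` is `WithConv (A →ₐ[k] R)`, the set of `k`-algebra morphisms with the convolution
product. -/

section Groups

variable {k : Type u} [Field k] (σ : k →+* k)

/-- The group `𝒢(R)`: the product is convolution, the inverse is composition with the antipode. -/
noncomputable instance pointsGroup {σ : k →+* k} (A : Type u) [CommRing A] [HopfAlgebra k A]
    (R : DiffAlg σ) : Group (WithConv (A →ₐ[k] R.carrier)) where
  inv g := WithConv.toConv (g.ofConv.comp (HopfAlgebra.antipodeAlgHom k A))
  inv_mul_cancel g := by
    have H := AlgHom.comp_convMul_distrib g.ofConv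
      (WithConv.toConv (HopfAlgebra.antipodeAlgHom k A)) (WithConv.toConv (AlgHom.id k A))
    rw [AlgHom.antipode_id_cancel] at H
    refine (WithConv.ofConv_injective H).symm.trans ?_
    ext a
    simp

/-- The functor `[σ]_k 𝒢`, which sends a `k`-`σ`-algebra `R` to the group of points of `𝒢` in the
`k`-algebra underlying `R`. -/
noncomputable def sigmaPoints (A : Type u) [CommRing A] [HopfAlgebra k A] :
    DiffAlg σ ⥤ GrpCat.{u} where
  obj R := GrpCat.of (WithConv (A →ₐ[k] R.carrier))
  map {R S} f := GrpCat.ofHom (MonoidHom.mk'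
    (fun g : WithConv (A →ₐ[k] R.carrier) =>
      (WithConv.toConv ((DiffAlg.algHom f).comp g.ofConv) : WithConv (A →ₐ[k] S.carrier)))
    (fun g h => by rw [AlgHom.comp_convMul_distrib]))

/-- A `σ`-algebraic group over `k`: a functor from `k`-`σ`-algebras to groups whose underlying
functor to sets is representable by a finitely `σ`-generated `k`-`σ`-algebra. -/
def IsSigmaAlgebraicGroup {σ : k →+* k} (G : DiffAlg σ ⥤ GrpCat.{u}) : Prop :=
  ∃ B : DiffAlg σ, B.IsFinitelySigmaGenerated ∧
    Nonempty ((G ⋙ forget GrpCat.{u}).CorepresentableBy B)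

/-- A `σ`-closed subgroup `G` of the algebraic group `𝒢` with coordinate ring `A`: for every
`k`-`σ`-algebra `R` a subgroup `G(R)` of `𝒢(R)`, such that the `G(R)` are the solution sets of one
system `F ⊆ k{𝒢}` of difference equations. -/
structure SigmaClosedSubgroup (A : Type u) [CommRing A] [HopfAlgebra k A] where
  points : ∀ R : DiffAlg σ, Subgroup (WithConv (A →ₐ[k] R.carrier))
  isSigmaClosed : ∃ F : Set (SigmaEnvelope.diffAlg σ A).carrier,
    ∀ (R : DiffAlg σ) (g : WithConv (A →ₐ[k] R.carrier)),
      g ∈ points R ↔ ∀ f ∈ F, SigmaEnvelope.eval g.ofConv f = 0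

namespace SigmaClosedSubgroup

variable {σ} {A : Type u} [CommRing A] [HopfAlgebra k A] (G : SigmaClosedSubgroup σ A)

/-- The defining ideal `𝕀(G)` of `G`: all `f ∈ k{𝒢}` such that `f(g) = 0` for all `k`-`σ`-algebras
`R` and all `g ∈ G(R)`. -/
noncomputable def vanishingIdeal : Ideal (SigmaEnvelope.diffAlg σ A).carrier :=
  ⨅ (R : DiffAlg σ) (g : G.points R), RingHom.ker (SigmaEnvelope.eval g.1.ofConv)

/-- The coordinate ring `k[𝒢[i]] / (𝕀(G) ∩ k[𝒢[i]])` of the `i`-th order Zariski closure `G[i]`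
of `G` in `𝒢`. -/
abbrev ZariskiClosureRing (i : ℕ) : Type u :=
  SigmaEnvelope.orderLE σ A i ⧸ G.vanishingIdeal.comap (SigmaEnvelope.orderLE σ A i).val

/-- The dimension of the `i`-th order Zariski closure `G[i]` of `G` in `𝒢`. -/
noncomputable def zariskiClosureDim (i : ℕ) : WithBot ℕ∞ :=
  ringKrullDim (G.ZariskiClosureRing i)

end SigmaClosedSubgroup

/-- `φ : G → 𝒢` is a morphism of group functors that is an isomorphism of `G` onto the `σ`-closed
subgroup `H` of `𝒢`. In other words: `φ` is a `σ`-closed embedding, with image `H`. -/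
def IsSigmaClosedEmbeddingOnto {σ : k →+* k} {A : Type u} [CommRing A] [HopfAlgebra k A]
    {G : DiffAlg σ ⥤ GrpCat.{u}} (φ : G ⟶ sigmaPoints σ A) (H : SigmaClosedSubgroup σ A) : Prop :=
  ∀ R : DiffAlg σ, Function.Injective (φ.app R).hom ∧ (φ.app R).hom.range = H.points R

end Groups

/-!
# The dimension polynomial of a `σ`-closed subgroup

Let `k{G} = k{𝒢} ⧸ 𝕀(G)` be the coordinate ring of a `σ`-closed subgroup `G`. It represents the
functor of points of `G`, so it is a Hopf algebra, and `σ` is a semilinear endomorphism of this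
Hopf algebra (`SigmaClosedSubgroup.isSemilinearHopfEndomorphism_sigma`). The coordinate ring of the Zariski
closure `G[i]` is the Hopf subalgebra `k[G[i]]` generated by the `σʲ(v)` with `j ≤ i` and `v` in the
image of `k[𝒢]`. By Noether normalization its dimension is its transcendence degree, the maximal
size of an algebraically independent family (`ringKrullDim_eq_toNat_trdeg`).

*Dimension formula.* For Hopf algebras `D ⊆ C` of finite type with kernel ring
`N = C ⧸ (augmentation ideal of D)`, one has `trdeg C = trdeg D + trdeg N`
(`IsComulStable.trdeg_eq_add`). Over every field-valued point of `C` the fibre of `D → C` is a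
translate of the kernel (`IsComulStable.fibreEquiv`), so all fibres that matter have the same
dimension. Faithful flatness of `C` over `D` can be avoided: an algebraically independent family
stays independent modulo a suitable prime ideal, and transcendence degrees of the residue fields are
additive (`Algebra.trdeg_eq_add_of_fibre_equiv`).

*Growth.* The endomorphism `σ` maps the kernel ring of `G[i] → G[i-1]` onto a set of generators of
the kernel ring of `G[i+1] → G[i]`, because the generators `σ⁰(v)` become constants there. A
semilinear map onto generators does not increase the transcendence degree
(`Algebra.trdeg_le_of_semilinear`). So the dimensions of the kernels form a decreasing sequence of
natural numbers, which becomes constant, with value `d`. Their partial sums are the dimensions of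
the `G[i]`, eventually equal to `d (i + 1) + e`, and `e ≥ 0` as each earlier kernel has dimension at
least `d` (`Antitone.exists_sum_range_eq`).

*Independence.* For two embeddings of the same group functor with images `G` and `G'`, transport of
the generic points gives an isomorphism of `k`-`σ`-algebras `k{G'} → k{G}`. Since `k[G'[0]]` is
finitely generated, it is mapped into some `k[G[m]]`, and then `k[G'[i]]` is mapped into `k[G[i+m]]`
for all `i`. Hence `d' (i + 1) + e' ≤ d (i + m + 1) + e` for large `i`, which gives `d' ≤ d`, and
`e' ≤ e` if `d = 0`. The claim follows by symmetry.
-/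

/-! ### Transcendence degree of algebras of finite type -/

section TranscendenceDegree

open Cardinal TensorProduct

variable {k : Type u} [Field k] {R : Type u} [CommRing R] [Algebra k R]

/-- An algebraically independent family stays so modulo a suitable prime ideal: a minimal prime of
the polynomial ring on the family lifts along its inclusion into `R`. -/
theorem AlgebraicIndependent.exists_isPrime_quotient {ι : Type*} {x : ι → R}
    (hx : AlgebraicIndependent k x) :
    ∃ q : Ideal R, q.IsPrime ∧ AlgebraicIndependent k (Ideal.Quotient.mkₐ k q ∘ x) := by
  obtain ⟨q, hq, hqx⟩ := Ideal.exists_comap_eq_of_mem_minimalPrimes_of_injective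
    (f := (MvPolynomial.aeval (R := k) x).toRingHom) hx ⊥
    (by simp [IsDomain.minimalPrimes_eq_singleton_bot])
  refine ⟨q, hq, ?_⟩
  rw [algebraicIndependent_iff_ker_eq_bot, ← hqx]
  ext p
  have : MvPolynomial.aeval (Ideal.Quotient.mkₐ k q ∘ x) p =
      Ideal.Quotient.mkₐ k q (MvPolynomial.aeval x p) := by
    rw [← AlgHom.comp_apply, MvPolynomial.comp_aeval]
    rfl
  exact (iff_of_eq (congrArg (· = 0) this)).trans Ideal.Quotient.eq_zero_iff_mem

theorem Algebra.trdeg_le_of_forall_isPrime {c : Cardinal.{u}}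
    (h : ∀ q : Ideal R, q.IsPrime → Algebra.trdeg k (R ⧸ q) ≤ c) : Algebra.trdeg k R ≤ c := by
  refine ciSup_le' fun s ↦ ?_
  obtain ⟨q, hq, hs⟩ := AlgebraicIndependent.exists_isPrime_quotient s.2
  exact hs.cardinalMk_le_trdeg.trans (h q hq)

/-- The map from the polynomial ring need not be injective: modulo every prime ideal, `R` is
algebraic over the subalgebra generated by the images of the variables. -/
theorem Algebra.trdeg_le_of_isIntegral {s : ℕ} (g : MvPolynomial (Fin s) k →ₐ[k] R)
    (hg : g.toRingHom.IsIntegral) : Algebra.trdeg k R ≤ s := by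
  refine Algebra.trdeg_le_of_forall_isPrime fun q hq ↦ ?_
  let x : Fin s → R ⧸ q := fun i ↦ Ideal.Quotient.mk q (g (MvPolynomial.X i))
  have hx : ∀ p, MvPolynomial.aeval x p = Ideal.Quotient.mk q (g p) := fun p ↦
    congrArg (fun φ : MvPolynomial (Fin s) k →ₐ[k] R ⧸ q ↦ φ p)
      (MvPolynomial.algHom_ext (f := MvPolynomial.aeval x) (g := (Ideal.Quotient.mkₐ k q).comp g)
        fun i ↦ by simp [x])
  have : Algebra.IsIntegral (Algebra.adjoin k (Set.range x)) (R ⧸ q) := by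
    refine ⟨fun y ↦ ?_⟩
    obtain ⟨y, rfl⟩ := Ideal.Quotient.mk_surjective y
    obtain ⟨p, hp, hpy⟩ := hg y
    let θ : MvPolynomial (Fin s) k →+* Algebra.adjoin k (Set.range x) :=
      ((MvPolynomial.aeval x).codRestrict _ fun p ↦ by
        rw [Algebra.adjoin_range_eq_range_aeval]; exact ⟨p, rfl⟩ :
        MvPolynomial (Fin s) k →ₐ[k] Algebra.adjoin k (Set.range x)).toRingHom
    refine ⟨p.map θ, hp.map θ, ?_⟩
    have h1 : (algebraMap (Algebra.adjoin k (Set.range x)) (R ⧸ q)).comp θ =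
        (Ideal.Quotient.mk q).comp g.toRingHom := RingHom.ext fun p ↦ hx p
    rw [Polynomial.eval₂_map, h1, ← Polynomial.hom_eval₂, hpy, map_zero]
  refine (Algebra.IsAlgebraic.trdeg_le_cardinalMk k (Set.range x)).trans ?_
  have := mk_range_le_lift (f := x)
  simpa using this

/-- Noether normalization: the transcendence degree is the number of variables. -/
theorem Algebra.FiniteType.exists_trdeg_eq (k R : Type u) [Field k] [CommRing R] [Nontrivial R]
    [Algebra k R] [Algebra.FiniteType k R] :
    ∃ (s : ℕ) (g : MvPolynomial (Fin s) k →ₐ[k] R), Function.Injective g ∧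
      g.toRingHom.IsIntegral ∧ Algebra.trdeg k R = s := by
  obtain ⟨s, g, hg, hg'⟩ := exists_integral_inj_algHom_of_fg k R
  refine ⟨s, g, hg, hg', (Algebra.trdeg_le_of_isIntegral g hg').antisymm ?_⟩
  have := lift_trdeg_le_of_injective g hg
  simpa using this

/-- A ring generated over a field `K` by the image of a `k`-algebra of finite type, under a ring
homomorphism that is semilinear over a homomorphism `k → K`, has at most the same transcendence
degree: the image of a Noether normalization normalizes it up to injectivity. -/
theorem Algebra.trdeg_le_of_semilinear {K : Type u} [Field K] (τ : k →+* K) {S : Type u}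
    [CommRing S] [Algebra K S] [Algebra.FiniteType k R] (φ : R →+* S)
    (hφ : ∀ c : k, φ (algebraMap k R c) = algebraMap K S (τ c))
    (hgen : Algebra.adjoin K (Set.range φ) = ⊤) : Algebra.trdeg K S ≤ Algebra.trdeg k R := by
  cases subsingleton_or_nontrivial R with
  | inl h =>
    have : Subsingleton S := φ.codomain_trivial
    have : ¬ Function.Injective (algebraMap K S) := fun h ↦
      zero_ne_one (h (Subsingleton.elim (algebraMap K S 0) (algebraMap K S 1)))
    rw [trdeg_eq_zero_of_not_injective this]
    exact zero_le
  | inr h =>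
    obtain ⟨s, g, -, hg, hs⟩ := Algebra.FiniteType.exists_trdeg_eq k R
    rw [hs]
    let f : MvPolynomial (Fin s) K →ₐ[K] S :=
      MvPolynomial.aeval fun i ↦ φ (g (MvPolynomial.X i))
    have hf : f.toRingHom.comp (MvPolynomial.map τ) = φ.comp g.toRingHom := by
      refine MvPolynomial.ringHom_ext (fun c ↦ ?_) fun i ↦ ?_
      · have hc : g (MvPolynomial.C c) = algebraMap k R c := g.commutes c
        simp [f, hc, hφ]
      · simp [f]
    refine Algebra.trdeg_le_of_isIntegral f fun y ↦ ?_
    have hy : y ∈ Algebra.adjoin K (Set.range φ) := hgen ▸ Algebra.mem_top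
    induction hy using Algebra.adjoin_induction with
    | mem y hy =>
      obtain ⟨r, rfl⟩ := hy
      obtain ⟨p, hp, hpr⟩ := hg r
      refine ⟨p.map (MvPolynomial.map τ), hp.map _, ?_⟩
      rw [Polynomial.eval₂_map, hf, ← Polynomial.hom_eval₂, hpr, map_zero]
    | algebraMap c =>
      have := f.toRingHom.isIntegralElem_map (x := MvPolynomial.C c)
      rwa [show f.toRingHom (MvPolynomial.C c) = algebraMap K S c from f.commutes c] at this
    | add a b _ _ ha hb => exact RingHom.IsIntegralElem.add _ ha hb
    | mul a b _ _ ha hb => exact RingHom.IsIntegralElem.mul _ ha hb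

theorem Algebra.trdeg_baseChange (K : Type u) [Field K] [Algebra k K] [Algebra.FiniteType k R] :
    Algebra.trdeg K (K ⊗[k] R) = Algebra.trdeg k R := by
  refine le_antisymm (Algebra.trdeg_le_of_semilinear (algebraMap k K)
    (Algebra.TensorProduct.includeRight : R →ₐ[k] K ⊗[k] R).toRingHom (fun c ↦ ?_) ?_) ?_
  · simp [Algebra.TensorProduct.algebraMap_apply, Algebra.TensorProduct.tmul_one_eq_one_tmul]
  · refine Algebra.eq_top_iff.2 fun y ↦ ?_
    induction y using TensorProduct.induction_on with
    | zero => exact zero_mem _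
    | add a b ha hb => exact add_mem ha hb
    | tmul c r =>
      rw [← mul_one c, ← smul_eq_mul, ← TensorProduct.smul_tmul']
      exact Subalgebra.smul_mem _ (Algebra.subset_adjoin (Set.mem_range_self r)) c
  · cases subsingleton_or_nontrivial R with
    | inl h =>
      have : ¬ Function.Injective (algebraMap k R) := fun h ↦
        zero_ne_one (h (Subsingleton.elim (algebraMap k R 0) (algebraMap k R 1)))
      rw [trdeg_eq_zero_of_not_injective this]
      exact zero_le
    | inr h =>
      obtain ⟨s, g, hg, -, hs⟩ := Algebra.FiniteType.exists_trdeg_eq k R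
      let f : MvPolynomial (Fin s) K →ₐ[K] K ⊗[k] R :=
        (Algebra.TensorProduct.map (AlgHom.id K K) g).comp
          (MvPolynomial.algebraTensorAlgEquiv k K).symm.toAlgHom
      have hf : Function.Injective f :=
        (Module.Flat.lTensor_preserves_injective_linearMap g.toLinearMap hg).comp
          (MvPolynomial.algebraTensorAlgEquiv k K).symm.injective
      have := lift_trdeg_le_of_injective f hf
      rw [hs]
      simpa using this

/-- For algebras of finite type over a field, the Krull dimension is the transcendence degree. -/
theorem ringKrullDim_eq_toNat_trdeg (k R : Type u) [Field k] [CommRing R] [Nontrivial R]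
    [Algebra k R] [Algebra.FiniteType k R] :
    ringKrullDim R = ((Cardinal.toNat (Algebra.trdeg k R) : ℕ) : WithBot ℕ∞) := by
  obtain ⟨s, g, hg, hg', hs⟩ := Algebra.FiniteType.exists_trdeg_eq k R
  let := g.toRingHom.toAlgebra
  have : Algebra.IsIntegral (MvPolynomial (Fin s) k) R := ⟨hg'⟩
  have hdim : ringKrullDim (MvPolynomial (Fin s) k) = ((s : ℕ) : WithBot ℕ∞) := by simp
  rw [hs, Cardinal.toNat_natCast, ← hdim]
  -- An injective integral extension preserves the dimension, by incomparability and going up.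
  apply le_antisymm
  · exact Order.krullDim_le_of_strictMono
      (PrimeSpectrum.comap (algebraMap (MvPolynomial (Fin s) k) R))
      fun p q hpq ↦ Ideal.IsIntegral.comap_lt_comap (I := p.asIdeal) (J := q.asIdeal) hpq
  · refine iSup_le fun l ↦ ?_
    obtain ⟨P, -, hP, hPl⟩ := Ideal.exists_ideal_over_prime_of_isIntegral
      l.head.asIdeal (⊥ : Ideal R) (by
        rw [Ideal.comap_bot_of_injective (algebraMap (MvPolynomial (Fin s) k) R) hg]
        exact bot_le)
    have : P.LiesOver l.head.asIdeal := ⟨hPl.symm⟩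
    obtain ⟨l', hl', -⟩ := Ideal.exists_ltSeries_of_hasGoingUp l P
    rw [← hl']
    exact Order.LTSeries.length_le_krullDim l'

section Fibres

variable {C D : Type u} [CommRing C] [CommRing D] [Algebra k C] [Algebra k D] [Algebra D C]
  [IsScalarTower k D C]

/-- The fraction fields of `D ⧸ (q ∩ D) ⊆ C ⧸ q`, as a tower over `D`. -/
theorem exists_algebra_fractionRing_quotient_under (q : Ideal C) [q.IsPrime] :
    ∃ _ : Algebra (FractionRing (D ⧸ q.under D)) (FractionRing (C ⧸ q)),
      IsScalarTower (D ⧸ q.under D) (FractionRing (D ⧸ q.under D)) (FractionRing (C ⧸ q)) ∧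
      IsScalarTower D (FractionRing (D ⧸ q.under D)) (FractionRing (C ⧸ q)) := by
  let L := FractionRing (D ⧸ q.under D)
  let K := FractionRing (C ⧸ q)
  let : Algebra L K := FractionRing.liftAlgebra (D ⧸ q.under D) K
  have : IsScalarTower (D ⧸ q.under D) L K := FractionRing.isScalarTower_liftAlgebra _ K
  refine ⟨inferInstance, inferInstance, .of_algebraMap_eq fun d ↦ ?_⟩
  rw [IsScalarTower.algebraMap_apply D (D ⧸ q.under D) L,
    ← IsScalarTower.algebraMap_apply (D ⧸ q.under D) L K,
    IsScalarTower.algebraMap_apply D (C ⧸ q) K,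
    IsScalarTower.algebraMap_apply (D ⧸ q.under D) (C ⧸ q) K,
    ← IsScalarTower.algebraMap_apply D (D ⧸ q.under D) (C ⧸ q)]

/-- The transcendence degree of `C ⧸ q` over `D ⧸ (q ∩ D)` is at most that of the fibre: an
algebraically independent family lifts to the fibre. -/
theorem Algebra.trdeg_quotient_le_trdeg_fibre (q : Ideal C) [q.IsPrime] :
    Algebra.trdeg (D ⧸ q.under D) (C ⧸ q) ≤
      Algebra.trdeg (FractionRing (D ⧸ q.under D)) (FractionRing (D ⧸ q.under D) ⊗[D] C) := by
  obtain ⟨_, _, _⟩ := exists_algebra_fractionRing_quotient_under (D := D) q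
  let L := FractionRing (D ⧸ q.under D)
  let K := FractionRing (C ⧸ q)
  refine ciSup_le' fun s ↦ ?_
  have hs : AlgebraicIndependent (D ⧸ q.under D) (algebraMap (C ⧸ q) K ∘ ((↑) : s.1 → C ⧸ q)) :=
    AlgebraicIndependent.map' (f := IsScalarTower.toAlgHom (D ⧸ q.under D) (C ⧸ q) K) s.2
      (IsFractionRing.injective (C ⧸ q) K)
  choose c hc using fun x : s.1 ↦ Ideal.Quotient.mk_surjective (x : C ⧸ q)
  let f : L ⊗[D] C →ₐ[L] K := Algebra.TensorProduct.lift (Algebra.ofId L K)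
    (IsScalarTower.toAlgHom D C K) fun _ _ ↦ .all _ _
  have hf : f ∘ (fun x ↦ 1 ⊗ₜ c x) = algebraMap (C ⧸ q) K ∘ ((↑) : s.1 → C ⧸ q) := by
    ext x
    simp only [f, Function.comp_apply, Algebra.TensorProduct.lift_tmul, map_one, one_mul,
      IsScalarTower.coe_toAlgHom']
    rw [IsScalarTower.algebraMap_apply C (C ⧸ q) K, Ideal.Quotient.algebraMap_eq, hc]
  have : Algebra.IsAlgebraic (D ⧸ q.under D) L :=
    IsLocalization.isAlgebraic _ (nonZeroDivisors (D ⧸ q.under D))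
  have hsL := hs.extendScalars L
  rw [← hf] at hsL
  exact hsL.of_comp.cardinalMk_le_trdeg

/-- An algebraically independent family in `D` that stays independent modulo a prime ideal `q` of
`C` can be enlarged in `C` by as many elements as the transcendence degree of the fibre over
`q ∩ D`: the fibre is generated by the image of `C`, which thus contains transcendence bases of its
quotients by prime ideals. -/
theorem Algebra.card_add_trdeg_fibre_le [Algebra.FiniteType D C] {h : ℕ} {y : Fin h → D}
    (q : Ideal C) [q.IsPrime]
    (hy : AlgebraicIndependent k (Ideal.Quotient.mkₐ k q ∘ (algebraMap D C ∘ y))) :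
    h + Algebra.trdeg (FractionRing (D ⧸ q.under D)) (FractionRing (D ⧸ q.under D) ⊗[D] C) ≤
      Algebra.trdeg k C := by
  obtain ⟨_, _, _⟩ := exists_algebra_fractionRing_quotient_under (D := D) q
  let L := FractionRing (D ⧸ q.under D)
  let K := FractionRing (C ⧸ q)
  let f : L ⊗[D] C →ₐ[L] K := Algebra.TensorProduct.lift (Algebra.ofId L K)
    (IsScalarTower.toAlgHom D C K) fun _ _ ↦ .all _ _
  have : Nontrivial (L ⊗[D] C) := f.toRingHom.domain_nontrivial
  have : IsScalarTower k L K := by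
    refine .of_algebraMap_eq fun c ↦ ?_
    rw [IsScalarTower.algebraMap_apply k D K, IsScalarTower.algebraMap_apply k D L,
      IsScalarTower.algebraMap_apply D L K]
  have hyL : AlgebraicIndependent k (algebraMap D L ∘ y) := by
    refine AlgebraicIndependent.of_comp (IsScalarTower.toAlgHom k L K) ?_
    convert hy.map' (f := IsScalarTower.toAlgHom k (C ⧸ q) K)
      (IsFractionRing.injective (C ⧸ q) K) using 1
    ext i
    simp only [Function.comp_apply, IsScalarTower.coe_toAlgHom', Ideal.Quotient.mkₐ_eq_mk]
    rw [← IsScalarTower.algebraMap_apply D L K, IsScalarTower.algebraMap_apply D C K,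
      IsScalarTower.algebraMap_apply C (C ⧸ q) K, Ideal.Quotient.algebraMap_eq]
  -- A prime ideal `Q` of the fibre whose quotient `E` has the transcendence degree of the fibre.
  obtain ⟨n, g, hg, -, hn⟩ := Algebra.FiniteType.exists_trdeg_eq L (L ⊗[D] C)
  have hz : AlgebraicIndependent L (fun i ↦ g (MvPolynomial.X i)) :=
    (MvPolynomial.algebraicIndependent_X (Fin n) L).map' hg
  obtain ⟨Q, hQ, hzQ⟩ := hz.exists_isPrime_quotient
  let E := (L ⊗[D] C) ⧸ Q
  let ψ : C →ₐ[D] E := (IsScalarTower.toAlgHom D (L ⊗[D] C) E).comp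
    Algebra.TensorProduct.includeRight
  have hgen : Algebra.adjoin L (Set.range ψ) = ⊤ := by
    refine Algebra.eq_top_iff.2 fun e ↦ ?_
    obtain ⟨e, rfl⟩ := Ideal.Quotient.mk_surjective e
    induction e using TensorProduct.induction_on with
    | zero => rw [map_zero]; exact zero_mem _
    | add a b ha hb => rw [map_add]; exact add_mem ha hb
    | tmul c r =>
      have : Ideal.Quotient.mk Q (c ⊗ₜ r) = c • ψ r := by
        rw [← mul_one c, ← smul_eq_mul, ← TensorProduct.smul_tmul', smul_eq_mul, mul_one]
        rfl
      rw [this]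
      exact Subalgebra.smul_mem _ (Algebra.subset_adjoin (Set.mem_range_self r)) c
  have : Algebra.IsAlgebraic (Algebra.adjoin L (Set.range ψ)) E :=
    ⟨fun e ↦ isAlgebraic_algebraMap (⟨e, hgen ▸ Algebra.mem_top⟩ : Algebra.adjoin L (Set.range ψ))⟩
  have : FaithfulSMul L E :=
    (faithfulSMul_iff_algebraMap_injective L E).2 (algebraMap L E).injective
  -- A transcendence basis of `E` over `L` in the image of `C`, lifted to `C`.
  obtain ⟨t, htψ, ht⟩ := exists_isTranscendenceBasis_subset (R := L) (Set.range ψ)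
  choose c hc using fun x : t ↦ htψ x.2
  have hfam := hyL.sumElim_comp ht.1
  have hlift : (ψ.restrictScalars k) ∘ (Sum.elim c (algebraMap D C ∘ y)) =
      Sum.elim ((↑) : t → E) (algebraMap L E ∘ (algebraMap D L ∘ y)) := by
    funext i
    rcases i with i | i
    · exact hc i
    · simp only [Function.comp_apply, Sum.elim_inr, AlgHom.coe_restrictScalars']
      rw [ψ.commutes, ← IsScalarTower.algebraMap_apply D L E]
  have hle := (AlgebraicIndependent.of_comp (ψ.restrictScalars k)
    (hlift ▸ hfam)).lift_cardinalMk_le_trdeg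
  have htn : (n : Cardinal.{u}) ≤ #t := by
    rw [ht.cardinalMk_eq_trdeg]
    simpa using hzQ.lift_cardinalMk_le_trdeg
  rw [hn]
  refine (add_le_add_right htn _).trans ?_
  simpa [add_comm] using hle

/-- If all fibres of `D → C` over field-valued points of `C` become isomorphic to `N` after an
extension of the base field, then the transcendence degrees add up. No flatness is needed: for
every prime ideal of `C` the transcendence degree of the residue field is bounded by the sum, and
equality holds for suitable prime ideals. -/
theorem Algebra.trdeg_eq_add_of_fibre_equiv {N : Type u} [CommRing N] [Algebra k N]
    [Algebra.FiniteType k C] [Algebra.FiniteType k D] [Algebra.FiniteType k N] [Nontrivial N]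
    [Nontrivial C] (hinj : Function.Injective (algebraMap D C))
    (H : ∀ (K : Type u) [Field K] [Algebra k K] [Algebra D K] [Algebra C K] [IsScalarTower D C K]
      [IsScalarTower k C K] [IsScalarTower k D K], Nonempty (K ⊗[D] C ≃ₐ[K] K ⊗[k] N)) :
    Algebra.trdeg k C = Algebra.trdeg k D + Algebra.trdeg k N := by
  have : Algebra.FiniteType D C := .of_restrictScalars_finiteType k D C
  have : Nontrivial D := (algebraMap D C).domain_nontrivial
  -- For a prime ideal `q` of `C`, the fibre over the prime ideal `p` of `D` below `q` has
  -- transcendence degree `trdeg k N` over the residue field `L` of `p`.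
  have key (q : Ideal C) [q.IsPrime] :
      Algebra.trdeg (FractionRing (D ⧸ q.under D)) (FractionRing (D ⧸ q.under D) ⊗[D] C) =
        Algebra.trdeg k N := by
    obtain ⟨_, _, _⟩ := exists_algebra_fractionRing_quotient_under (D := D) q
    let L := FractionRing (D ⧸ q.under D)
    let K := FractionRing (C ⧸ q)
    obtain ⟨e⟩ := H K
    rw [← Algebra.trdeg_baseChange (k := L) K,
      (Algebra.TensorProduct.cancelBaseChange D L K K C).trdeg_eq, e.trdeg_eq,
      Algebra.trdeg_baseChange]
  apply le_antisymm
  · refine Algebra.trdeg_le_of_forall_isPrime fun q hq ↦ ?_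
    rw [← key q, ← trdeg_add_eq k (D ⧸ q.under D)]
    exact add_le_add (trdeg_le_of_surjective (Ideal.Quotient.mkₐ k _)
      (Ideal.Quotient.mkₐ_surjective _ _)) (Algebra.trdeg_quotient_le_trdeg_fibre q)
  -- Equality holds for a prime ideal of `C` modulo which a Noether normalization of `D` stays
  -- independent.
  · obtain ⟨h, g, hg, -, hh⟩ := Algebra.FiniteType.exists_trdeg_eq k D
    have hy : AlgebraicIndependent k (algebraMap D C ∘ fun i ↦ g (MvPolynomial.X i)) :=
      ((MvPolynomial.algebraicIndependent_X (Fin h) k).map' hg).map'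
        (f := IsScalarTower.toAlgHom k D C) hinj
    obtain ⟨q, hq, hyq⟩ := hy.exists_isPrime_quotient
    rw [hh, ← key q]
    exact Algebra.card_add_trdeg_fibre_le q hyq

end Fibres

end TranscendenceDegree

/-! ### Fibres of homomorphisms of affine groups -/

section HopfFibres

open TensorProduct WithConv

variable {k : Type u} [Field k]

theorem AlgHom.id_convMul_antipode (C : Type u) [CommRing C] [HopfAlgebra k C] :
    toConv (AlgHom.id k C) * toConv (HopfAlgebra.antipodeAlgHom k C) = 1 := by
  apply WithConv.ofConv_injective
  apply AlgHom.toLinearMap_injective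
  apply WithConv.toConv_injective
  rw [AlgHom.toLinearMap_convMul, AlgHom.toLinearMap_convOne]
  exact LinearMap.id_mul_antipode

theorem AlgHom.convMul_comp_antipode {C R : Type u} [CommRing C] [HopfAlgebra k C] [CommRing R]
    [Algebra k R] (x : C →ₐ[k] R) :
    toConv x * toConv (x.comp (HopfAlgebra.antipodeAlgHom k C)) = 1 := by
  have h := AlgHom.comp_convMul_distrib x (toConv (AlgHom.id k C))
    (toConv (HopfAlgebra.antipodeAlgHom k C))
  rw [AlgHom.id_convMul_antipode] at h
  refine (WithConv.ofConv_injective h).symm.trans ?_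
  ext a
  simp

theorem AlgHom.comp_antipode_convMul {C R : Type u} [CommRing C] [HopfAlgebra k C] [CommRing R]
    [Algebra k R] (x : C →ₐ[k] R) :
    toConv (x.comp (HopfAlgebra.antipodeAlgHom k C)) * toConv x = 1 := by
  have h := AlgHom.comp_convMul_distrib x (toConv (HopfAlgebra.antipodeAlgHom k C))
    (toConv (AlgHom.id k C))
  rw [AlgHom.antipode_id_cancel] at h
  refine (WithConv.ofConv_injective h).symm.trans ?_
  ext a
  simp

theorem AlgHom.convMul_convMul_antipode_cancel {C R : Type u} [CommRing C] [HopfAlgebra k C]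
    [CommRing R] [Algebra k R] (f x : C →ₐ[k] R) :
    toConv f * toConv x * toConv (x.comp (HopfAlgebra.antipodeAlgHom k C)) = toConv f := by
  rw [mul_assoc, AlgHom.convMul_comp_antipode, mul_one]

theorem AlgHom.convMul_antipode_convMul_cancel {C R : Type u} [CommRing C] [HopfAlgebra k C]
    [CommRing R] [Algebra k R] (f x : C →ₐ[k] R) :
    toConv f * toConv (x.comp (HopfAlgebra.antipodeAlgHom k C)) * toConv x = toConv f := by
  rw [mul_assoc, AlgHom.comp_antipode_convMul, mul_one]

theorem AlgHom.one_convMul_apply {C R : Type u} [CommRing C] [HopfAlgebra k C]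
    [CommRing R] [Algebra k R] (x : C →ₐ[k] R) (c : C) :
    (toConv (1 : WithConv (C →ₐ[k] R)).ofConv * toConv x) c = x c := by
  rw [WithConv.toConv_ofConv, one_mul]

variable (D C : Type u) [CommRing D] [Algebra k D] [CommRing C] [HopfAlgebra k C] [Algebra D C]
  [IsScalarTower k D C]

variable (k) in
/-- The extension to `C` of the augmentation ideal of `D ⊆ C`: the ideal of the kernel of the
homomorphism of affine groups with coordinate rings `D ⊆ C`. -/
noncomputable def augmentationIdealMap : Ideal C :=
  (RingHom.ker ((Bialgebra.counitAlgHom k C).comp (IsScalarTower.toAlgHom k D C))).map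
    (algebraMap D C)

theorem augmentationIdealMap_le_ker_counit :
    augmentationIdealMap k D C ≤ RingHom.ker (Bialgebra.counitAlgHom k C) :=
  Ideal.map_le_iff_le_comap.2 fun _ hd ↦ hd

variable (k) in
/-- The elements of `D ⊆ C` have their comultiplication in `D ⊗ D`. -/
def IsComulStable : Prop :=
  ∀ d : D, Coalgebra.comul (R := k) (algebraMap D C d) ∈
    (Algebra.TensorProduct.map (IsScalarTower.toAlgHom k D C) (IsScalarTower.toAlgHom k D C)).range

variable {D C}

/-- On a subalgebra stable under comultiplication, a convolution product only depends on the
restriction of the factors to it. -/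
theorem IsComulStable.convMul_apply_congr {R : Type u} [CommRing R] [Algebra k R]
    (hD : IsComulStable k D C) {f f' : C →ₐ[k] R} (g : C →ₐ[k] R)
    (hf : ∀ d : D, f (algebraMap D C d) = f' (algebraMap D C d)) (d : D) :
    (toConv f * toConv g) (algebraMap D C d) = (toConv f' * toConv g) (algebraMap D C d) := by
  obtain ⟨t, ht⟩ := hD d
  simp only [AlgHom.convMul_apply]
  rw [← ht]
  change ((Algebra.TensorProduct.lift f g fun _ _ ↦ .all _ _).comp
      (Algebra.TensorProduct.map _ _)) t =
    ((Algebra.TensorProduct.lift f' g fun _ _ ↦ .all _ _).comp (Algebra.TensorProduct.map _ _)) t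
  congr 1
  ext d
  · simpa using hf d
  · simp

variable (K : Type u) [Field K] [Algebra k K] [Algebra D K] [Algebra C K] [IsScalarTower D C K]
  [IsScalarTower k C K] [IsScalarTower k D K]

/-- Over a field-valued point `x` of an affine group, the fibre of a homomorphism is a translate of
the kernel: the isomorphism is multiplication by `x`, and its inverse is multiplication by
`x⁻¹`. -/
noncomputable def IsComulStable.fibreEquiv (hD : IsComulStable k D C) :
    K ⊗[D] C ≃ₐ[K] K ⊗[k] (C ⧸ augmentationIdealMap k D C) := by
  let π : C →ₐ[k] C ⧸ augmentationIdealMap k D C := Ideal.Quotient.mkₐ k _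
  have hπ : ∀ d : D, π (algebraMap D C d) =
      algebraMap k (C ⧸ augmentationIdealMap k D C)
        (Coalgebra.counit (R := k) (algebraMap D C d)) := fun d ↦ by
    have : algebraMap D C (d - algebraMap k D (Coalgebra.counit (R := k) (algebraMap D C d))) ∈
        augmentationIdealMap k D C := by
      refine Ideal.mem_map_of_mem _ ?_
      simp [RingHom.mem_ker, ← IsScalarTower.algebraMap_apply]
    rw [map_sub, ← IsScalarTower.algebraMap_apply] at this
    exact Ideal.Quotient.eq.2 this
  let x : C →ₐ[k] K := IsScalarTower.toAlgHom k C K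
  let S := HopfAlgebra.antipodeAlgHom k C
  -- The coordinates of a point of the kernel, multiplied by `x`.
  let jN : K →ₐ[k] K ⊗[k] (C ⧸ augmentationIdealMap k D C) :=
    Algebra.TensorProduct.includeLeft
  let iN : C →ₐ[k] K ⊗[k] (C ⧸ augmentationIdealMap k D C) :=
    Algebra.TensorProduct.includeRight.comp π
  let a : C →ₐ[k] K ⊗[k] (C ⧸ augmentationIdealMap k D C) :=
    (toConv iN * toConv (jN.comp x)).ofConv
  have ha : ∀ d : D, a (algebraMap D C d) =
      algebraMap D (K ⊗[k] (C ⧸ augmentationIdealMap k D C)) d := fun d ↦ by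
    have := hD.convMul_apply_congr (f := iN)
      (f' := ((1 : WithConv (C →ₐ[k] K ⊗[k] (C ⧸ augmentationIdealMap k D C))).ofConv)) (jN.comp x)
      (fun d ↦ by
        change 1 ⊗ₜ π (algebraMap D C d) = algebraMap k (K ⊗[k] (C ⧸ augmentationIdealMap k D C)) _
        rw [hπ, Algebra.TensorProduct.algebraMap_apply, Algebra.TensorProduct.tmul_one_eq_one_tmul]
        rfl)
      d
    refine this.trans ((AlgHom.one_convMul_apply (jN.comp x) _).trans ?_)
    change x (algebraMap D C d) ⊗ₜ (1 : C ⧸ augmentationIdealMap k D C) =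
      algebraMap D K d ⊗ₜ (1 : C ⧸ augmentationIdealMap k D C)
    rw [IsScalarTower.algebraMap_apply D C K]
    rfl
  let aD : C →ₐ[D] K ⊗[k] (C ⧸ augmentationIdealMap k D C) := { a with commutes' := ha }
  let α : K ⊗[D] C →ₐ[K] K ⊗[k] (C ⧸ augmentationIdealMap k D C) :=
    Algebra.TensorProduct.lift (Algebra.ofId K _) aD fun _ _ ↦ .all _ _
  -- The coordinates of a point of the fibre, multiplied by `x⁻¹`.
  let jC : K →ₐ[k] K ⊗[D] C :=
    (Algebra.TensorProduct.includeLeft : K →ₐ[K] K ⊗[D] C).restrictScalars k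
  let iC : C →ₐ[k] K ⊗[D] C :=
    (Algebra.TensorProduct.includeRight : C →ₐ[D] K ⊗[D] C).restrictScalars k
  let b : C →ₐ[k] K ⊗[D] C := (toConv iC * toConv (jC.comp (x.comp S))).ofConv
  have hb : ∀ d : D, b (algebraMap D C d) =
      algebraMap k _ (Coalgebra.counit (R := k) (algebraMap D C d)) := fun d ↦ by
    have := hD.convMul_apply_congr (f := iC) (f' := jC.comp x) (jC.comp (x.comp S))
      (fun d ↦ by
        change 1 ⊗ₜ algebraMap D C d = algebraMap C K (algebraMap D C d) ⊗ₜ 1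
        rw [← IsScalarTower.algebraMap_apply D C K, Algebra.algebraMap_eq_smul_one (A := K),
          Algebra.algebraMap_eq_smul_one (A := C), TensorProduct.tmul_smul,
          TensorProduct.smul_tmul'])
      d
    rw [← AlgHom.comp_assoc, AlgHom.convMul_comp_antipode] at this
    exact this
  let b' : (C ⧸ augmentationIdealMap k D C) →ₐ[k] K ⊗[D] C := Ideal.Quotient.liftₐ _ b fun c hc ↦ by
    have : augmentationIdealMap k D C ≤ RingHom.ker b :=
      Ideal.map_le_iff_le_comap.2 fun d hd ↦ by
        rw [Ideal.mem_comap, RingHom.mem_ker, hb]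
        rw [show Coalgebra.counit (R := k) (algebraMap D C d) = 0 from hd, map_zero]
    exact this hc
  have hb' : b'.comp π = b := AlgHom.ext fun c ↦ rfl
  let β : K ⊗[k] (C ⧸ augmentationIdealMap k D C) →ₐ[K] K ⊗[D] C :=
    Algebra.TensorProduct.lift (Algebra.ofId K _) b' fun _ _ ↦ .all _ _
  let αk : K ⊗[D] C →ₐ[k] K ⊗[k] (C ⧸ augmentationIdealMap k D C) := α.restrictScalars k
  let βk : K ⊗[k] (C ⧸ augmentationIdealMap k D C) →ₐ[k] K ⊗[D] C := β.restrictScalars k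
  have hαj : αk.comp jC = jN := AlgHom.ext fun c ↦ by
    change algebraMap K (K ⊗[k] (C ⧸ augmentationIdealMap k D C)) c * aD 1 = c ⊗ₜ 1
    rw [map_one, mul_one]; rfl
  have hαi : αk.comp iC = a := AlgHom.ext fun c ↦ by
    change algebraMap K (K ⊗[k] (C ⧸ augmentationIdealMap k D C)) 1 * a c = a c
    rw [map_one, one_mul]
  have hβj : βk.comp jN = jC := AlgHom.ext fun c ↦ by
    change algebraMap K (K ⊗[D] C) c * b' 1 = c ⊗ₜ 1
    rw [map_one, mul_one]; rfl
  have hβi : βk.comp iN = b := AlgHom.ext fun c ↦ by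
    change algebraMap K (K ⊗[D] C) 1 * b c = b c
    rw [map_one, one_mul]
  have hαb : αk.comp b = iN := by
    rw [AlgHom.comp_convMul_distrib]
    simp only
    rw [hαi, ← AlgHom.comp_assoc, hαj]
    exact congrArg ofConv (AlgHom.convMul_convMul_antipode_cancel iN (jN.comp x))
  have hβa : βk.comp a = iC := by
    rw [AlgHom.comp_convMul_distrib]
    simp only
    rw [hβi, ← AlgHom.comp_assoc, hβj]
    exact congrArg ofConv (AlgHom.convMul_antipode_convMul_cancel iC (jC.comp x))
  refine AlgEquiv.ofAlgHom α β ?_ ?_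
  · refine Algebra.TensorProduct.ext (by ext) (Ideal.Quotient.algHom_ext k ?_)
    refine AlgHom.ext fun c ↦ ?_
    have h1 := DFunLike.congr_fun hβi c
    have h2 := DFunLike.congr_fun hαb c
    exact (congrArg αk h1).trans h2
  · refine Algebra.TensorProduct.ext (by ext) (AlgHom.ext fun c ↦ ?_)
    have h1 := DFunLike.congr_fun hαi c
    have h2 := DFunLike.congr_fun hβa c
    exact (congrArg βk h1).trans h2

/-- The dimension formula for the homomorphism of affine groups with coordinate rings `D ⊆ C`. -/
theorem IsComulStable.trdeg_eq_add (hD : IsComulStable k D C) [Algebra.FiniteType k C]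
    [Algebra.FiniteType k D] (hinj : Function.Injective (algebraMap D C)) :
    Algebra.trdeg k C =
      Algebra.trdeg k D + Algebra.trdeg k (C ⧸ augmentationIdealMap k D C) := by
  have : Nontrivial C := (Bialgebra.counitAlgHom k C).toRingHom.domain_nontrivial
  have : Nontrivial (C ⧸ augmentationIdealMap k D C) := Ideal.Quotient.nontrivial_iff.2 fun h ↦ by
    have := augmentationIdealMap_le_ker_counit (k := k) D C
    rw [h, top_le_iff] at this
    exact RingHom.ker_ne_top _ this
  exact Algebra.trdeg_eq_add_of_fibre_equiv hinj fun K ↦ ⟨hD.fibreEquiv K⟩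

end HopfFibres

/-! ### Hopf subalgebras -/

section HopfSubalgebra

open TensorProduct

variable {k : Type u} [Field k] {B : Type u} [CommRing B] [HopfAlgebra k B]

theorem Subalgebra.map_val_val_injective (C : Subalgebra k B) :
    Function.Injective (Algebra.TensorProduct.map C.val C.val) :=
  TensorProduct.map_injective_of_flat_flat C.val.toLinearMap C.val.toLinearMap
    Subtype.val_injective Subtype.val_injective

/-- The comultiplication of a subalgebra stable under comultiplication. -/
noncomputable def IsComulStable.comulAlgHom {C : Subalgebra k B} (hC : IsComulStable k C B) :
    C →ₐ[k] C ⊗[k] C :=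
  (AlgEquiv.ofInjective _ C.map_val_val_injective).symm.toAlgHom.comp
    (((Bialgebra.comulAlgHom k B).comp C.val).codRestrict
      (Algebra.TensorProduct.map C.val C.val).range hC)

theorem IsComulStable.map_comp_comulAlgHom {C : Subalgebra k B} (hC : IsComulStable k C B) :
    (Algebra.TensorProduct.map C.val C.val).comp hC.comulAlgHom =
      (Bialgebra.comulAlgHom k B).comp C.val := by
  refine AlgHom.ext fun c ↦ ?_
  exact congrArg Subtype.val ((AlgEquiv.ofInjective _ C.map_val_val_injective).apply_symm_apply
    (((Bialgebra.comulAlgHom k B).comp C.val).codRestrict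
      (Algebra.TensorProduct.map C.val C.val).range hC c))

theorem AlgHom.eq_of_comp_injective {R S T : Type u} [Semiring R] [Semiring S] [Semiring T]
    [Algebra k R] [Algebra k S] [Algebra k T] (j : S →ₐ[k] T) (hj : Function.Injective j)
    {f g : R →ₐ[k] S} (h : j.comp f = j.comp g) : f = g :=
  AlgHom.ext fun r ↦ hj (DFunLike.congr_fun h r)

theorem Bialgebra.assoc_comp_map_comul_comp_comul :
    (Algebra.TensorProduct.assoc k k k B B B).toAlgHom.comp
      ((Algebra.TensorProduct.map (Bialgebra.comulAlgHom k B) (.id k B)).comp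
        (Bialgebra.comulAlgHom k B)) =
    (Algebra.TensorProduct.map (.id k B) (Bialgebra.comulAlgHom k B)).comp
      (Bialgebra.comulAlgHom k B) :=
  AlgHom.toLinearMap_injective Coalgebra.coassoc

theorem Bialgebra.map_counit_id_comp_comul :
    (Algebra.TensorProduct.map (Bialgebra.counitAlgHom k B) (.id k B)).comp
      (Bialgebra.comulAlgHom k B) = (Algebra.TensorProduct.lid k B).symm :=
  AlgHom.toLinearMap_injective Coalgebra.rTensor_counit_comp_comul

theorem Bialgebra.map_id_counit_comp_comul :
    (Algebra.TensorProduct.map (.id k B) (Bialgebra.counitAlgHom k B)).comp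
      (Bialgebra.comulAlgHom k B) = (Algebra.TensorProduct.rid k k B).symm :=
  AlgHom.toLinearMap_injective Coalgebra.lTensor_counit_comp_comul

section Bialgebra

variable {C : Subalgebra k B} (hC : IsComulStable k C B)

theorem IsComulStable.assoc_comp_map_comul_comp_comul :
    (Algebra.TensorProduct.assoc k k k C C C).toAlgHom.comp
      ((Algebra.TensorProduct.map hC.comulAlgHom (.id k C)).comp hC.comulAlgHom) =
    (Algebra.TensorProduct.map (.id k C) hC.comulAlgHom).comp hC.comulAlgHom := by
  let v := C.val
  let δ := hC.comulAlgHom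
  let Δ := Bialgebra.comulAlgHom k B
  have hδ : (Algebra.TensorProduct.map v v).comp δ = Δ.comp v := hC.map_comp_comulAlgHom
  let j : C ⊗[k] (C ⊗[k] C) →ₐ[k] B ⊗[k] (B ⊗[k] B) :=
    Algebra.TensorProduct.map v (Algebra.TensorProduct.map v v)
  have hj : Function.Injective j :=
    TensorProduct.map_injective_of_flat_flat v.toLinearMap
      (Algebra.TensorProduct.map v v).toLinearMap Subtype.val_injective C.map_val_val_injective
  refine AlgHom.eq_of_comp_injective j hj ?_
  have h1 : j.comp (Algebra.TensorProduct.assoc k k k C C C).toAlgHom =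
      (Algebra.TensorProduct.assoc k k k B B B).toAlgHom.comp
        (Algebra.TensorProduct.map (Algebra.TensorProduct.map v v) v) := by
    ext <;> simp [j, Algebra.TensorProduct.one_def]
  have h2 : (Algebra.TensorProduct.map (Algebra.TensorProduct.map v v) v).comp
      (Algebra.TensorProduct.map δ (.id k C)) =
      (Algebra.TensorProduct.map Δ (.id k B)).comp (Algebra.TensorProduct.map v v) := by
    rw [← Algebra.TensorProduct.map_comp, hδ, ← Algebra.TensorProduct.map_comp]
    rfl
  have h3 : j.comp (Algebra.TensorProduct.map (.id k C) δ) =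
      (Algebra.TensorProduct.map (.id k B) Δ).comp (Algebra.TensorProduct.map v v) := by
    rw [← Algebra.TensorProduct.map_comp, hδ, ← Algebra.TensorProduct.map_comp]
    rfl
  calc j.comp ((Algebra.TensorProduct.assoc k k k C C C).toAlgHom.comp
        ((Algebra.TensorProduct.map δ (.id k C)).comp δ))
      = (Algebra.TensorProduct.assoc k k k B B B).toAlgHom.comp
          (((Algebra.TensorProduct.map (Algebra.TensorProduct.map v v) v).comp
            (Algebra.TensorProduct.map δ (.id k C))).comp δ) := by
        rw [← AlgHom.comp_assoc, h1]
        rfl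
    _ = ((Algebra.TensorProduct.assoc k k k B B B).toAlgHom.comp
          ((Algebra.TensorProduct.map Δ (.id k B)).comp Δ)).comp v := by
        rw [h2, AlgHom.comp_assoc, hδ]
        rfl
    _ = (Algebra.TensorProduct.map (.id k B) Δ).comp (Δ.comp v) := by
        rw [Bialgebra.assoc_comp_map_comul_comp_comul, AlgHom.comp_assoc]
    _ = j.comp ((Algebra.TensorProduct.map (.id k C) δ).comp δ) := by
        rw [← hδ, ← AlgHom.comp_assoc, ← h3, AlgHom.comp_assoc]

theorem IsComulStable.map_counit_id_comp_comul :
    (Algebra.TensorProduct.map ((Bialgebra.counitAlgHom k B).comp C.val) (.id k C)).comp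
      hC.comulAlgHom = (Algebra.TensorProduct.lid k C).symm := by
  refine AlgHom.eq_of_comp_injective (Algebra.TensorProduct.map (.id k k) C.val)
    (TensorProduct.map_injective_of_flat_flat LinearMap.id C.val.toLinearMap
      Function.injective_id Subtype.val_injective) ?_
  have h1 : (Algebra.TensorProduct.map (.id k k) C.val).comp
      ((Algebra.TensorProduct.lid k C).symm : C →ₐ[k] k ⊗[k] C) =
      ((Algebra.TensorProduct.lid k B).symm : B →ₐ[k] k ⊗[k] B).comp C.val := by
    ext; simp
  rw [h1, ← Bialgebra.map_counit_id_comp_comul, AlgHom.comp_assoc, ← hC.map_comp_comulAlgHom,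
    ← AlgHom.comp_assoc, ← AlgHom.comp_assoc, ← Algebra.TensorProduct.map_comp,
    ← Algebra.TensorProduct.map_comp]
  rfl

theorem IsComulStable.map_id_counit_comp_comul :
    (Algebra.TensorProduct.map (.id k C) ((Bialgebra.counitAlgHom k B).comp C.val)).comp
      hC.comulAlgHom = (Algebra.TensorProduct.rid k k C).symm := by
  refine AlgHom.eq_of_comp_injective (Algebra.TensorProduct.map C.val (.id k k))
    (TensorProduct.map_injective_of_flat_flat C.val.toLinearMap LinearMap.id
      Subtype.val_injective Function.injective_id) ?_
  have h1 : (Algebra.TensorProduct.map C.val (.id k k)).comp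
      ((Algebra.TensorProduct.rid k k C).symm : C →ₐ[k] C ⊗[k] k) =
      ((Algebra.TensorProduct.rid k k B).symm : B →ₐ[k] B ⊗[k] k).comp C.val := by
    ext; simp
  rw [h1, ← Bialgebra.map_id_counit_comp_comul, AlgHom.comp_assoc, ← hC.map_comp_comulAlgHom,
    ← AlgHom.comp_assoc, ← AlgHom.comp_assoc, ← Algebra.TensorProduct.map_comp,
    ← Algebra.TensorProduct.map_comp]
  rfl

/-- The bialgebra structure on a subalgebra stable under comultiplication. -/
noncomputable abbrev IsComulStable.bialgebra : Bialgebra k C :=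
  Bialgebra.ofAlgHom hC.comulAlgHom ((Bialgebra.counitAlgHom k B).comp C.val)
    hC.assoc_comp_map_comul_comp_comul hC.map_counit_id_comp_comul hC.map_id_counit_comp_comul

end Bialgebra

theorem Bialgebra.lift_antipode_id_comul (b : B) :
    Algebra.TensorProduct.lift (HopfAlgebra.antipodeAlgHom k B) (.id k B) (fun _ _ ↦ .all _ _)
      (Bialgebra.comulAlgHom k B b) = algebraMap k B (Bialgebra.counitAlgHom k B b) :=
  (AlgHom.convMul_apply _ _ b).symm.trans
    (congrArg (fun f : WithConv (B →ₐ[k] B) ↦ f b) AlgHom.antipode_id_cancel)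

theorem Bialgebra.lift_id_antipode_comul (b : B) :
    Algebra.TensorProduct.lift (.id k B) (HopfAlgebra.antipodeAlgHom k B) (fun _ _ ↦ .all _ _)
      (Bialgebra.comulAlgHom k B b) = algebraMap k B (Bialgebra.counitAlgHom k B b) :=
  (AlgHom.convMul_apply _ _ b).symm.trans
    (congrArg (fun f : WithConv (B →ₐ[k] B) ↦ f b) (AlgHom.id_convMul_antipode B))

/-- The restriction of the antipode to a subalgebra stable under it. -/
noncomputable def Subalgebra.antipodeAlgHom (C : Subalgebra k B)
    (hS : ∀ c ∈ C, HopfAlgebra.antipode k c ∈ C) : C →ₐ[k] C :=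
  ((HopfAlgebra.antipodeAlgHom k B).comp C.val).codRestrict C fun c ↦ hS c c.2

theorem Subalgebra.val_comp_lift_antipode_id (C : Subalgebra k B)
    (hS : ∀ c ∈ C, HopfAlgebra.antipode k c ∈ C) :
    C.val.comp (Algebra.TensorProduct.lift (C.antipodeAlgHom hS) (.id k C) fun _ _ ↦ .all _ _) =
      (Algebra.TensorProduct.lift (HopfAlgebra.antipodeAlgHom k B) (.id k B)
        fun _ _ ↦ .all _ _).comp (Algebra.TensorProduct.map C.val C.val) := by
  ext c
  · simp [Subalgebra.antipodeAlgHom]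
    rfl
  · simp [Subalgebra.antipodeAlgHom]

theorem Subalgebra.val_comp_lift_id_antipode (C : Subalgebra k B)
    (hS : ∀ c ∈ C, HopfAlgebra.antipode k c ∈ C) :
    C.val.comp (Algebra.TensorProduct.lift (.id k C) (C.antipodeAlgHom hS) fun _ _ ↦ .all _ _) =
      (Algebra.TensorProduct.lift (.id k B) (HopfAlgebra.antipodeAlgHom k B)
        fun _ _ ↦ .all _ _).comp (Algebra.TensorProduct.map C.val C.val) := by
  ext c
  · simp [Subalgebra.antipodeAlgHom]
  · simp [Subalgebra.antipodeAlgHom]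
    rfl

/-- The Hopf algebra structure on a subalgebra stable under comultiplication and antipode. -/
noncomputable abbrev IsComulStable.hopfAlgebra {C : Subalgebra k B} (hC : IsComulStable k C B)
    (hS : ∀ c ∈ C, HopfAlgebra.antipode k c ∈ C) : HopfAlgebra k C :=
  letI := hC.bialgebra
  HopfAlgebra.ofAlgHom
    (C.antipodeAlgHom hS)
    (by
      refine AlgHom.eq_of_comp_injective C.val Subtype.val_injective ?_
      rw [← AlgHom.comp_assoc, C.val_comp_lift_antipode_id hS]
      change (AlgHom.comp _ _).comp hC.comulAlgHom = _
      rw [AlgHom.comp_assoc, hC.map_comp_comulAlgHom]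
      exact AlgHom.ext fun c ↦ Bialgebra.lift_antipode_id_comul (c : B))
    (by
      refine AlgHom.eq_of_comp_injective C.val Subtype.val_injective ?_
      rw [← AlgHom.comp_assoc, C.val_comp_lift_id_antipode hS]
      change (AlgHom.comp _ _).comp hC.comulAlgHom = _
      rw [AlgHom.comp_assoc, hC.map_comp_comulAlgHom]
      exact AlgHom.ext fun c ↦ Bialgebra.lift_id_antipode_comul (c : B))

/-- For subalgebras `D ≤ C`, the ideal of `C` generated by the augmentation ideal of `D`. -/
noncomputable def Subalgebra.augmentationSpan (D C : Subalgebra k B) : Ideal C :=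
  Ideal.span {c : C | (c : B) ∈ D ∧ Coalgebra.counit (R := k) (c : B) = 0}

/-- The dimension formula for Hopf subalgebras `D ≤ C`. -/
theorem IsComulStable.trdeg_eq_add_augmentationSpan {D C : Subalgebra k B}
    (hD : IsComulStable k D B) (hC : IsComulStable k C B)
    (hS : ∀ c ∈ C, HopfAlgebra.antipode k c ∈ C) (hDC : D ≤ C) (hDfg : D.FG) (hCfg : C.FG) :
    Algebra.trdeg k C = Algebra.trdeg k D + Algebra.trdeg k (C ⧸ D.augmentationSpan C) := by
  let := hC.hopfAlgebra hS
  let : Algebra D C := (Subalgebra.inclusion hDC).toAlgebra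
  have : IsScalarTower k D C := .of_algebraMap_eq fun c ↦ rfl
  have : Algebra.FiniteType k C := C.fg_iff_finiteType.1 hCfg
  have : Algebra.FiniteType k D := D.fg_iff_finiteType.1 hDfg
  have hDC' : IsComulStable k D C := fun d ↦ by
    obtain ⟨t, ht⟩ := hD d
    refine ⟨t, C.map_val_val_injective ?_⟩
    have h1 : (Algebra.TensorProduct.map C.val C.val).comp (Algebra.TensorProduct.map
        (IsScalarTower.toAlgHom k D C) (IsScalarTower.toAlgHom k D C)) =
        Algebra.TensorProduct.map D.val D.val := by
      rw [← Algebra.TensorProduct.map_comp]; rfl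
    exact (DFunLike.congr_fun h1 t).trans (ht.trans
      (DFunLike.congr_fun hC.map_comp_comulAlgHom (Subalgebra.inclusion hDC d)).symm)
  have hI : augmentationIdealMap k D C = D.augmentationSpan C := by
    refine congrArg Ideal.span (Set.ext fun c ↦ ⟨?_, fun hc ↦ ⟨⟨c, hc.1⟩, hc.2, rfl⟩⟩)
    rintro ⟨d, hd, rfl⟩
    exact ⟨d.2, hd⟩
  rw [← hI]
  exact hDC'.trdeg_eq_add (Subalgebra.inclusion_injective hDC)

end HopfSubalgebra

/-! ### The growth of dimensions in a Hopf algebra with an endomorphism -/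

section Growth

open TensorProduct

/-- The partial sums of an antitone sequence of natural numbers are eventually of the form
`d * (i + 1) + e`. -/
theorem Antitone.exists_sum_range_eq {n : ℕ → ℕ} (hn : Antitone n) :
    ∃ d e : ℕ, ∀ᶠ i in Filter.atTop, ∑ j ∈ Finset.range (i + 1), n j = d * (i + 1) + e := by
  obtain ⟨i₀, h⟩ := WellFoundedLT.antitone_chain_condition hn
  refine ⟨n i₀, ∑ j ∈ Finset.range i₀, (n j - n i₀), Filter.eventually_atTop.2 ⟨i₀, fun i hi ↦ ?_⟩⟩
  induction i, hi using Nat.le_induction with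
  | base =>
    rw [Finset.sum_range_succ, mul_add, mul_one, add_right_comm]
    congr 1
    have : n i₀ * i₀ = ∑ j ∈ Finset.range i₀, n i₀ := by simp [mul_comm]
    rw [this, ← Finset.sum_add_distrib]
    exact Finset.sum_congr rfl fun j hj ↦
      (Nat.add_sub_cancel' (hn (Finset.mem_range.1 hj).le)).symm
  | succ i hi ih =>
    rw [Finset.sum_range_succ, ih, ← h (i + 1) (hi.trans i.le_succ)]
    ring

variable {k : Type u} [Field k] {B : Type u} [CommRing B]

/-- The subalgebra generated by the iterates `sʲ(v)` with `v ∈ V` and `j < i`. -/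
noncomputable def iterateAdjoin [Algebra k B] (s : B →+* B) (V : Subalgebra k B) (i : ℕ) :
    Subalgebra k B :=
  Algebra.adjoin k {b | ∃ j < i, ∃ v ∈ V, b = s^[j] v}

section Algebra

variable [Algebra k B] {σ : k →+* k} {s : B →+* B} (V : Subalgebra k B)

theorem iterateAdjoin_zero : iterateAdjoin s V 0 = ⊥ := by
  simp [iterateAdjoin]

theorem iterateAdjoin_mono : Monotone (iterateAdjoin s V) := fun _ _ h ↦
  Algebra.adjoin_mono fun _ ⟨j, hj, v, hv, hb⟩ ↦ ⟨j, hj.trans_le h, v, hv, hb⟩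

variable {V} in
theorem iterate_mem_iterateAdjoin {i j : ℕ} (hj : j < i) {v : B} (hv : v ∈ V) :
    s^[j] v ∈ iterateAdjoin s V i :=
  Algebra.subset_adjoin ⟨j, hj, v, hv, rfl⟩

theorem apply_mem_of_mem_adjoin (hs : ∀ c : k, s (algebraMap k B c) = algebraMap k B (σ c))
    {S : Set B} {T : Subalgebra k B} (h : ∀ b ∈ S, s b ∈ T) {b : B}
    (hb : b ∈ Algebra.adjoin k S) : s b ∈ T := by
  induction hb using Algebra.adjoin_induction with
  | mem b hb => exact h b hb
  | algebraMap c => rw [hs]; exact T.algebraMap_mem _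
  | add a b _ _ ha hb => rw [map_add]; exact add_mem ha hb
  | mul a b _ _ ha hb => rw [map_mul]; exact mul_mem ha hb

theorem iterate_algebraMap (hs : ∀ c : k, s (algebraMap k B c) = algebraMap k B (σ c)) (j : ℕ)
    (c : k) : s^[j] (algebraMap k B c) = algebraMap k B ((σ ^ j) c) := by
  induction j with
  | zero => rfl
  | succ j ih => rw [Function.iterate_succ_apply', ih, hs, pow_succ']; rfl

variable {V}

theorem apply_mem_iterateAdjoin_succ (hs : ∀ c : k, s (algebraMap k B c) = algebraMap k B (σ c))
    {i : ℕ} {b : B} (hb : b ∈ iterateAdjoin s V i) : s b ∈ iterateAdjoin s V (i + 1) := by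
  refine apply_mem_of_mem_adjoin hs ?_ hb
  rintro _ ⟨j, hj, v, hv, rfl⟩
  rw [← Function.iterate_succ_apply' s j v]
  exact iterate_mem_iterateAdjoin (Nat.succ_lt_succ hj) hv

theorem iterateAdjoin_fg (hs : ∀ c : k, s (algebraMap k B c) = algebraMap k B (σ c))
    (hV : V.FG) (i : ℕ) : (iterateAdjoin s V i).FG := by
  obtain ⟨S, hS⟩ := hV
  have hfin : ((fun p : ℕ × B ↦ s^[p.1] p.2) '' (Set.Iio i ×ˢ (S : Set B))).Finite :=
    ((Set.finite_Iio i).prod S.finite_toSet).image _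
  refine ⟨hfin.toFinset, le_antisymm (Algebra.adjoin_le ?_) (Algebra.adjoin_le ?_)⟩
  · rw [hfin.coe_toFinset]
    rintro _ ⟨⟨j, v⟩, ⟨hj, hv⟩, rfl⟩
    exact iterate_mem_iterateAdjoin hj (hS ▸ Algebra.subset_adjoin hv)
  · rintro _ ⟨j, hj, v, hv, rfl⟩
    rw [hfin.coe_toFinset]
    rw [← hS] at hv
    rw [SetLike.mem_coe, ← RingHom.coe_pow]
    refine apply_mem_of_mem_adjoin (σ := σ ^ j) (fun c ↦ ?_) (fun b hb ↦ ?_) hv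
    · rw [RingHom.coe_pow, iterate_algebraMap hs]
    · exact Algebra.subset_adjoin ⟨(j, b), ⟨hj, hb⟩, by simp [RingHom.coe_pow]⟩

end Algebra

/-- An endomorphism `s` of the ring underlying a Hopf algebra, semilinear over `σ` and compatible
with the Hopf algebra structure. The endomorphism `s ⊗ s` of `B ⊗ B` is not linear, so it enters
through its values. -/
structure IsSemilinearHopfEndomorphism [HopfAlgebra k B] (σ : k →+* k) (s : B →+* B) : Prop where
  map_algebraMap : ∀ c : k, s (algebraMap k B c) = algebraMap k B (σ c)
  map_counit : ∀ b : B, Coalgebra.counit (R := k) (s b) = σ (Coalgebra.counit (R := k) b)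
  map_antipode : ∀ b : B, HopfAlgebra.antipode k (s b) = s (HopfAlgebra.antipode k b)
  exists_map_comul : ∃ t : B ⊗[k] B →+* B ⊗[k] B, (∀ a b : B, t (a ⊗ₜ b) = s a ⊗ₜ s b) ∧
    ∀ b : B, Coalgebra.comul (R := k) (s b) = t (Coalgebra.comul (R := k) b)

variable [HopfAlgebra k B] {σ : k →+* k} {s : B →+* B} {V : Subalgebra k B}

theorem Subalgebra.range_map_val_val_mono {D C : Subalgebra k B} (h : D ≤ C) :
    (Algebra.TensorProduct.map D.val D.val).range ≤
      (Algebra.TensorProduct.map C.val C.val).range := by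
  rintro _ ⟨t, rfl⟩
  refine ⟨Algebra.TensorProduct.map (Subalgebra.inclusion h) (Subalgebra.inclusion h) t, ?_⟩
  have h1 : (Algebra.TensorProduct.map C.val C.val).comp
      (Algebra.TensorProduct.map (Subalgebra.inclusion h) (Subalgebra.inclusion h)) =
      Algebra.TensorProduct.map D.val D.val := by
    rw [← Algebra.TensorProduct.map_comp]; rfl
  exact DFunLike.congr_fun h1 t

theorem isComulStable_iterateAdjoin (hs : IsSemilinearHopfEndomorphism σ s)
    (hV : IsComulStable k V B) (i : ℕ) : IsComulStable k (iterateAdjoin s V i) B := by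
  obtain ⟨t, ht, hts⟩ := hs.exists_map_comul
  let P (i : ℕ) : Subalgebra k (B ⊗[k] B) :=
    (Algebra.TensorProduct.map (iterateAdjoin s V i).val (iterateAdjoin s V i).val).range
  have hP : ∀ i, ∀ x ∈ P i, t x ∈ P (i + 1) := by
    rintro i _ ⟨x, rfl⟩
    induction x using TensorProduct.induction_on with
    | zero => simp
    | add x y hx hy =>
      rw [map_add, map_add]
      exact add_mem hx hy
    | tmul a b =>
      refine ⟨(⟨s a, apply_mem_iterateAdjoin_succ hs.map_algebraMap a.2⟩ :
        iterateAdjoin s V (i + 1)) ⊗ₜ (⟨s b, apply_mem_iterateAdjoin_succ hs.map_algebraMap b.2⟩ :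
        iterateAdjoin s V (i + 1)), ?_⟩
      exact (ht a b).symm
  have hcomul (v : B) (hv : v ∈ V) (j : ℕ) :
      Coalgebra.comul (R := k) (s^[j] v) ∈ P (j + 1) := by
    induction j with
    | zero =>
      exact Subalgebra.range_map_val_val_mono
        (fun w hw ↦ iterate_mem_iterateAdjoin (j := 0) one_pos hw) (hV ⟨v, hv⟩)
    | succ j ih =>
      rw [Function.iterate_succ_apply', hts]
      exact hP _ _ ih
  have hle : iterateAdjoin s V i ≤ (P i).comap (Bialgebra.comulAlgHom k B) := by
    refine Algebra.adjoin_le ?_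
    rintro _ ⟨j, hj, v, hvV, rfl⟩
    exact Subalgebra.range_map_val_val_mono (iterateAdjoin_mono V hj) (hcomul v hvV j)
  exact fun d ↦ hle d.2

theorem antipode_mem_iterateAdjoin (hs : IsSemilinearHopfEndomorphism σ s)
    (hV : ∀ v ∈ V, HopfAlgebra.antipode k v ∈ V) (i : ℕ) :
    ∀ b ∈ iterateAdjoin s V i, HopfAlgebra.antipode k b ∈ iterateAdjoin s V i := by
  have hj (v : B) (j : ℕ) :
      HopfAlgebra.antipode k (s^[j] v) = s^[j] (HopfAlgebra.antipode k v) := by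
    induction j with
    | zero => rfl
    | succ j ih => rw [Function.iterate_succ_apply', hs.map_antipode, ih,
        Function.iterate_succ_apply']
  have hle : iterateAdjoin s V i ≤
      (iterateAdjoin s V i).comap (HopfAlgebra.antipodeAlgHom k B) := by
    refine Algebra.adjoin_le ?_
    rintro _ ⟨j, hji, v, hvV, rfl⟩
    change HopfAlgebra.antipode k (s^[j] v) ∈ iterateAdjoin s V i
    rw [hj]
    exact iterate_mem_iterateAdjoin hji (hV v hvV)
  exact fun b hb ↦ hle hb

/-- The coordinate ring of the kernel of the projection between consecutive stages. -/
abbrev IterateKernel (s : B →+* B) (V : Subalgebra k B) (i : ℕ) : Type u :=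
  iterateAdjoin s V (i + 1) ⧸ (iterateAdjoin s V i).augmentationSpan (iterateAdjoin s V (i + 1))

/-- The restriction of `s` to consecutive stages. -/
noncomputable def iterateAdjoinShift (hs : IsSemilinearHopfEndomorphism σ s) (V : Subalgebra k B)
    (i : ℕ) : iterateAdjoin s V i →+* iterateAdjoin s V (i + 1) :=
  (s.comp (iterateAdjoin s V i).val.toRingHom).codRestrict _
    fun b ↦ apply_mem_iterateAdjoin_succ hs.map_algebraMap b.2

theorem coe_iterateAdjoinShift (hs : IsSemilinearHopfEndomorphism σ s) (i : ℕ)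
    (b : iterateAdjoin s V i) : (iterateAdjoinShift hs V i b : B) = s b := rfl

theorem Subalgebra.mem_augmentationSpan {D C : Subalgebra k B} {c : C} (hc : (c : B) ∈ D)
    (hc' : Coalgebra.counit (R := k) (c : B) = 0) : c ∈ D.augmentationSpan C :=
  Ideal.subset_span ⟨hc, hc'⟩

theorem augmentationSpan_le_comap_shift (hs : IsSemilinearHopfEndomorphism σ s) (i : ℕ) :
    (iterateAdjoin s V i).augmentationSpan (iterateAdjoin s V (i + 1)) ≤
      ((iterateAdjoin s V (i + 1)).augmentationSpan (iterateAdjoin s V (i + 1 + 1))).comap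
        (iterateAdjoinShift hs V (i + 1)) := by
  rw [Subalgebra.augmentationSpan, Ideal.span_le]
  rintro b ⟨hb, hb'⟩
  rw [SetLike.mem_coe, Ideal.mem_comap]
  apply Subalgebra.mem_augmentationSpan
  · rw [coe_iterateAdjoinShift]
    exact apply_mem_iterateAdjoin_succ hs.map_algebraMap hb
  · rw [coe_iterateAdjoinShift, hs.map_counit, hb', map_zero]

/-- The semilinear map induced by `s` between the coordinate rings of consecutive kernels. -/
noncomputable def iterateKernelMap (hs : IsSemilinearHopfEndomorphism σ s) (V : Subalgebra k B)
    (i : ℕ) : IterateKernel s V i →+* IterateKernel s V (i + 1) :=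
  Ideal.quotientMap _ (iterateAdjoinShift hs V (i + 1)) (augmentationSpan_le_comap_shift hs i)

theorem iterateKernelMap_mk (hs : IsSemilinearHopfEndomorphism σ s) (i : ℕ)
    (b : iterateAdjoin s V (i + 1)) :
    iterateKernelMap hs V i (Ideal.Quotient.mk _ b) =
      Ideal.Quotient.mk _ (iterateAdjoinShift hs V (i + 1) b) :=
  Ideal.quotientMap_mk

/-- The image of one kernel ring generates the next: `v` is a constant modulo the augmentation
ideal, and the other generators `sʲ⁺¹(v)` are images of `sʲ(v)`. -/
theorem adjoin_range_iterateKernelMap (hs : IsSemilinearHopfEndomorphism σ s) (i : ℕ) :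
    Algebra.adjoin k (Set.range (iterateKernelMap hs V i)) = ⊤ := by
  let J := (iterateAdjoin s V (i + 1)).augmentationSpan (iterateAdjoin s V (i + 1 + 1))
  let T : Subalgebra k (iterateAdjoin s V (i + 1 + 1)) :=
    (Algebra.adjoin k (Set.range (iterateKernelMap hs V i))).comap (Ideal.Quotient.mkₐ k J)
  have hT : iterateAdjoin s V (i + 1 + 1) ≤ T.map (iterateAdjoin s V (i + 1 + 1)).val := by
    refine Algebra.adjoin_le ?_
    rintro _ ⟨j, hj, v, hv, rfl⟩
    refine ⟨⟨s^[j] v, iterate_mem_iterateAdjoin hj hv⟩, ?_, rfl⟩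
    cases j with
    | zero =>
      have h0 : v ∈ iterateAdjoin s V (i + 1) :=
        iterate_mem_iterateAdjoin (j := 0) i.succ_pos hv
      let w : iterateAdjoin s V (i + 1 + 1) := ⟨v, iterateAdjoin_mono V (i + 1).le_succ h0⟩
      let c : iterateAdjoin s V (i + 1 + 1) := algebraMap k _ (Coalgebra.counit (R := k) v)
      have hwc : w - c ∈ J := by
        refine Subalgebra.mem_augmentationSpan (sub_mem h0 (Subalgebra.algebraMap_mem _ _)) ?_
        have : ((w - c : iterateAdjoin s V (i + 1 + 1)) : B) =
          v - algebraMap k B (Coalgebra.counit (R := k) v) := rfl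
        rw [this]
        simp
      have hmk : Ideal.Quotient.mkₐ k J w = Ideal.Quotient.mkₐ k J c := Ideal.Quotient.eq.2 hwc
      have hc : c ∈ T := T.algebraMap_mem _
      change Ideal.Quotient.mkₐ k J w ∈ Algebra.adjoin k (Set.range (iterateKernelMap hs V i))
      rw [hmk]
      exact hc
    | succ j =>
      refine Algebra.subset_adjoin ⟨Ideal.Quotient.mk _ ⟨s^[j] v,
        iterate_mem_iterateAdjoin (Nat.lt_of_succ_lt_succ hj) hv⟩, ?_⟩
      rw [iterateKernelMap_mk]
      refine congrArg (Ideal.Quotient.mk J) (Subtype.ext ?_)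
      rw [coe_iterateAdjoinShift]
      exact (Function.iterate_succ_apply' s j v).symm
  refine Algebra.eq_top_iff.2 fun y ↦ ?_
  obtain ⟨y, rfl⟩ := Ideal.Quotient.mk_surjective y
  obtain ⟨y', hy', hyy⟩ := hT y.2
  rw [← Subtype.ext hyy]
  exact hy'

theorem iterateKernelMap_algebraMap (hs : IsSemilinearHopfEndomorphism σ s) (i : ℕ) (c : k) :
    iterateKernelMap hs V i (algebraMap k _ c) = algebraMap k _ (σ c) := by
  have h : iterateAdjoinShift hs V (i + 1) (algebraMap k _ c) = algebraMap k _ (σ c) :=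
    Subtype.ext (hs.map_algebraMap c)
  exact (iterateKernelMap_mk hs i _).trans (congrArg (Ideal.Quotient.mk _) h)

/-- The kernels of the projections between consecutive stages have decreasing dimensions. -/
theorem trdeg_iterateKernel_succ_le (hs : IsSemilinearHopfEndomorphism σ s) (hV : V.FG) (i : ℕ) :
    Algebra.trdeg k (IterateKernel s V (i + 1)) ≤ Algebra.trdeg k (IterateKernel s V i) := by
  have : Algebra.FiniteType k (iterateAdjoin s V (i + 1)) :=
    (Subalgebra.fg_iff_finiteType _).1 (iterateAdjoin_fg hs.map_algebraMap hV _)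
  exact Algebra.trdeg_le_of_semilinear σ (iterateKernelMap hs V i)
    (iterateKernelMap_algebraMap hs i) (adjoin_range_iterateKernelMap hs i)

/-- The transcendence degrees of the stages are eventually linear: they are the partial sums of the
decreasing sequence of the dimensions of the kernels. -/
theorem exists_trdeg_iterateAdjoin_eq (hs : IsSemilinearHopfEndomorphism σ s) (hfg : V.FG)
    (hV : IsComulStable k V B) (hVS : ∀ v ∈ V, HopfAlgebra.antipode k v ∈ V) :
    ∃ d e : ℕ, ∀ᶠ i in Filter.atTop,
      Cardinal.toNat (Algebra.trdeg k (iterateAdjoin s V (i + 1))) = d * (i + 1) + e := by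
  have hft (i : ℕ) : Algebra.FiniteType k (iterateAdjoin s V i) :=
    (Subalgebra.fg_iff_finiteType _).1 (iterateAdjoin_fg hs.map_algebraMap hfg i)
  let n (i : ℕ) : ℕ := Cardinal.toNat (Algebra.trdeg k (IterateKernel s V i))
  have hn : Antitone n := antitone_nat_of_succ_le fun i ↦
    Cardinal.toNat_le_toNat (trdeg_iterateKernel_succ_le hs hfg i) trdeg_lt_aleph0_of_finiteType
  have hsum (i : ℕ) : Cardinal.toNat (Algebra.trdeg k (iterateAdjoin s V i)) =
      ∑ j ∈ Finset.range i, n j := by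
    induction i with
    | zero =>
      have : Algebra.trdeg k (iterateAdjoin s V 0) ≤ 0 := by
        have : Nontrivial B := (Bialgebra.counitAlgHom k B).toRingHom.domain_nontrivial
        rw [iterateAdjoin_zero, (Algebra.botEquiv k B).trdeg_eq]
        exact trdeg_eq_zero.le
      simp [nonpos_iff_eq_zero.1 this]
    | succ i ih =>
      rw [Finset.sum_range_succ, ← ih, IsComulStable.trdeg_eq_add_augmentationSpan
        (isComulStable_iterateAdjoin hs hV i) (isComulStable_iterateAdjoin hs hV (i + 1))
        (antipode_mem_iterateAdjoin hs hVS _) (iterateAdjoin_mono V i.le_succ)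
        (iterateAdjoin_fg hs.map_algebraMap hfg _) (iterateAdjoin_fg hs.map_algebraMap hfg _)]
      exact Cardinal.toNat_add trdeg_lt_aleph0_of_finiteType trdeg_lt_aleph0_of_finiteType
  simp only [hsum]
  exact hn.exists_sum_range_eq

end Growth

/-! ### Tensor products of `k`-`σ`-algebras -/

namespace DiffAlg

open TensorProduct

variable {k : Type u} [Field k] {σ : k →+* k}

/-- A morphism of rings out of `R ⊗ S` from morphisms that agree on `k`. The target carries no
`k`-algebra structure, so that the morphisms may be semilinear. -/
noncomputable def tensorLift {R S W : Type u} [CommRing R] [CommRing S] [CommRing W] [Algebra k R]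
    [Algebra k S] (f : R →+* W) (g : S →+* W)
    (h : ∀ c : k, f (algebraMap k R c) = g (algebraMap k S c)) : R ⊗[k] S →+* W :=
  letI := (f.comp (algebraMap k R)).toAlgebra
  (Algebra.TensorProduct.lift (S := k) (A := R) (B := S) (C := W)
    { f with commutes' := fun _ ↦ rfl } { g with commutes' := fun c ↦ (h c).symm }
    fun _ _ ↦ .all _ _).toRingHom

theorem tensorLift_tmul {R S W : Type u} [CommRing R] [CommRing S] [CommRing W] [Algebra k R]
    [Algebra k S] (f : R →+* W) (g : S →+* W)
    (h : ∀ c : k, f (algebraMap k R c) = g (algebraMap k S c)) (r : R) (s : S) :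
    tensorLift f g h (r ⊗ₜ s) = f r * g s := rfl

/-- The semilinear endomorphism `σ ⊗ σ` of a tensor product of `k`-`σ`-algebras. -/
noncomputable def tensorSigma (R S : DiffAlg σ) :
    R.carrier ⊗[k] S.carrier →+* R.carrier ⊗[k] S.carrier :=
  tensorLift
    ((Algebra.TensorProduct.includeLeft : R.carrier →ₐ[k] _).toRingHom.comp R.sigma)
    ((Algebra.TensorProduct.includeRight : S.carrier →ₐ[k] _).toRingHom.comp S.sigma) fun c ↦ by
      simp [sigma_algebraMap]

theorem tensorSigma_tmul (R S : DiffAlg σ) (r : R.carrier) (s : S.carrier) :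
    tensorSigma R S (r ⊗ₜ s) = R.sigma r ⊗ₜ S.sigma s := by
  rw [tensorSigma, tensorLift_tmul]
  simp

/-- The tensor product of `k`-`σ`-algebras, with `σ ⊗ σ`. -/
noncomputable abbrev tensor (R S : DiffAlg σ) : DiffAlg σ where
  carrier := R.carrier ⊗[k] S.carrier
  sigma := tensorSigma R S
  sigma_algebraMap c := by
    rw [Algebra.TensorProduct.algebraMap_apply, tensorSigma_tmul]
    simp [sigma_algebraMap]

theorem tensor_sigma_tmul (R S : DiffAlg σ) (r : R.carrier) (s : S.carrier) :
    (tensor R S).sigma (r ⊗ₜ s) = R.sigma r ⊗ₜ S.sigma s :=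
  tensorSigma_tmul R S r s

/-- The difference field `k` as a `k`-`σ`-algebra. -/
abbrev base (σ : k →+* k) : DiffAlg σ where
  carrier := k
  sigma := σ
  sigma_algebraMap _ := rfl

/-- A morphism of `k`-algebras commutes with `σ`. -/
def SigmaCompat {R S : DiffAlg σ} (f : R.carrier →ₐ[k] S.carrier) : Prop :=
  ∀ r, f (R.sigma r) = S.sigma (f r)

theorem SigmaCompat.id (R : DiffAlg σ) : SigmaCompat (AlgHom.id k R.carrier) := fun _ ↦ rfl

theorem SigmaCompat.comp {R S T : DiffAlg σ} {g : S.carrier →ₐ[k] T.carrier}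
    {f : R.carrier →ₐ[k] S.carrier} (hg : SigmaCompat g) (hf : SigmaCompat f) :
    SigmaCompat (g.comp f) := fun r ↦ by
  rw [AlgHom.comp_apply, hf, hg, AlgHom.comp_apply]

theorem SigmaCompat.of_tmul {R S T : DiffAlg σ} {f : (tensor R S).carrier →ₐ[k] T.carrier}
    (h : ∀ r s, f (R.sigma r ⊗ₜ S.sigma s) = T.sigma (f (r ⊗ₜ s))) : SigmaCompat f := fun x ↦ by
  induction x using TensorProduct.induction_on with
  | zero => simp
  | add x y hx hy => rw [map_add, map_add, map_add, map_add, hx, hy]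
  | tmul r s => rw [tensor_sigma_tmul, h]

theorem SigmaCompat.includeLeft (R S : DiffAlg σ) :
    SigmaCompat (R := R) (S := tensor R S) Algebra.TensorProduct.includeLeft := fun r ↦ by
  rw [Algebra.TensorProduct.includeLeft_apply, Algebra.TensorProduct.includeLeft_apply,
    tensor_sigma_tmul, map_one]

theorem SigmaCompat.includeRight (R S : DiffAlg σ) :
    SigmaCompat (R := S) (S := tensor R S) Algebra.TensorProduct.includeRight := fun r ↦ by
  rw [Algebra.TensorProduct.includeRight_apply, Algebra.TensorProduct.includeRight_apply,
    tensor_sigma_tmul, map_one]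

theorem SigmaCompat.map {R S R' S' : DiffAlg σ} {f : R.carrier →ₐ[k] R'.carrier}
    {g : S.carrier →ₐ[k] S'.carrier} (hf : SigmaCompat f) (hg : SigmaCompat g) :
    SigmaCompat (R := tensor R S) (S := tensor R' S') (Algebra.TensorProduct.map f g) :=
  .of_tmul fun r s ↦ by
    rw [Algebra.TensorProduct.map_tmul, Algebra.TensorProduct.map_tmul, hf, hg, tensor_sigma_tmul]

theorem SigmaCompat.lift {R S T : DiffAlg σ} {f : R.carrier →ₐ[k] T.carrier}
    {g : S.carrier →ₐ[k] T.carrier} (hf : SigmaCompat f) (hg : SigmaCompat g) :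
    SigmaCompat (R := tensor R S) (Algebra.TensorProduct.lift f g fun _ _ ↦ .all _ _) :=
  .of_tmul fun r s ↦ by
    rw [Algebra.TensorProduct.lift_tmul, Algebra.TensorProduct.lift_tmul, hf, hg, map_mul]

theorem SigmaCompat.assoc (R S T : DiffAlg σ) :
    SigmaCompat (R := tensor (tensor R S) T) (S := tensor R (tensor S T))
      (Algebra.TensorProduct.assoc k k k R.carrier S.carrier T.carrier).toAlgHom := by
  refine SigmaCompat.of_tmul (R := tensor R S) (S := T) (T := tensor R (tensor S T)) fun x t ↦ ?_
  induction x using TensorProduct.induction_on with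
  | zero => simp
  | add x y hx hy => rw [map_add, add_tmul, add_tmul, map_add, map_add, map_add, hx, hy]
  | tmul r s =>
    rw [tensor_sigma_tmul]
    change (R.sigma r) ⊗ₜ[k] ((S.sigma s) ⊗ₜ[k] (T.sigma t)) =
      (tensor R (tensor S T)).sigma (r ⊗ₜ[k] (s ⊗ₜ[k] t))
    rw [tensor_sigma_tmul, tensor_sigma_tmul]

theorem SigmaCompat.lid_symm (R : DiffAlg σ) :
    SigmaCompat (S := tensor (base σ) R)
      ((Algebra.TensorProduct.lid k R.carrier).symm : R.carrier →ₐ[k] k ⊗[k] R.carrier) :=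
  SigmaCompat.includeRight (base σ) R

theorem SigmaCompat.rid_symm (R : DiffAlg σ) :
    SigmaCompat (S := tensor R (base σ))
      ((Algebra.TensorProduct.rid k k R.carrier).symm : R.carrier →ₐ[k] R.carrier ⊗[k] k) :=
  SigmaCompat.includeLeft R (base σ)

theorem SigmaCompat.ofId (R : DiffAlg σ) :
    SigmaCompat (R := base σ) (Algebra.ofId k R.carrier) := fun c ↦ (R.sigma_algebraMap c).symm

end DiffAlg

/-! ### The coordinate ring of a `σ`-closed subgroup -/

theorem SigmaEnvelope.algHom_ext_gen {k : Type u} [Field k] {σ : k →+* k} {A : Type u} [CommRing A]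
    [Algebra k A] {R : Type u} [CommRing R] [Algebra k R]
    {f g : (SigmaEnvelope.diffAlg σ A).carrier →ₐ[k] R}
    (h : ∀ i a, f (SigmaEnvelope.gen σ A i a) = g (SigmaEnvelope.gen σ A i a)) : f = g :=
  Ideal.Quotient.algHom_ext k (MvPolynomial.algHom_ext fun p ↦ h p.1 p.2)

theorem SigmaEnvelope.iterate_sigma_incl {k : Type u} [Field k] {σ : k →+* k} {A : Type u}
    [CommRing A] [Algebra k A] (i : ℕ) (a : A) :
    (SigmaEnvelope.diffAlg σ A).sigma^[i] (SigmaEnvelope.incl σ A a) =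
      SigmaEnvelope.gen σ A i a := by
  induction i with
  | zero => rfl
  | succ i ih => rw [Function.iterate_succ_apply', ih, SigmaEnvelope.sigma_gen]

namespace SigmaClosedSubgroup

open TensorProduct WithConv DiffAlg

variable {k : Type u} [Field k] {σ : k →+* k} {A : Type u} [CommRing A] [HopfAlgebra k A]
  (G : SigmaClosedSubgroup σ A)

/-- Although `G` may be given by any system of equations, its points are the zeros of the ideal of
all functions that vanish on `G`. -/
theorem mem_points_iff {R : DiffAlg σ} {g : A →ₐ[k] R.carrier} :
    toConv g ∈ G.points R ↔ ∀ f ∈ G.vanishingIdeal, SigmaEnvelope.eval g f = 0 := by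
  refine ⟨fun hg f hf ↦ ?_, fun h ↦ ?_⟩
  · have h1 := (Submodule.mem_iInf _).1 hf R
    exact (Submodule.mem_iInf _).1 h1 ⟨toConv g, hg⟩
  · obtain ⟨F, hF⟩ := G.isSigmaClosed
    refine (hF R _).2 fun f hf ↦ h f ?_
    refine (Submodule.mem_iInf _).2 fun S ↦ (Submodule.mem_iInf _).2 fun g' ↦ ?_
    exact (hF S _).1 g'.2 f hf

theorem vanishingIdeal_le_comap :
    G.vanishingIdeal ≤ G.vanishingIdeal.comap (SigmaEnvelope.diffAlg σ A).sigma := fun f hf ↦ by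
  refine (Submodule.mem_iInf _).2 fun R ↦ (Submodule.mem_iInf _).2 fun g ↦ ?_
  have : SigmaEnvelope.eval g.1.ofConv f = 0 := G.mem_points_iff.1 g.2 f hf
  rw [RingHom.mem_ker]
  exact (SigmaEnvelope.eval_sigma _ f).trans (by rw [this, map_zero])

/-- The `k`-`σ`-algebra `k{G}`, the quotient of `k{𝒢}` by the defining ideal of `G`. -/
noncomputable def coordAlg : DiffAlg σ where
  carrier := SigmaEnvelope.Ring σ A ⧸ G.vanishingIdeal
  sigma := Ideal.quotientMap _ (SigmaEnvelope.diffAlg σ A).sigma G.vanishingIdeal_le_comap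
  sigma_algebraMap c :=
    (Ideal.quotientMap_mk (x := algebraMap k (SigmaEnvelope.diffAlg σ A).carrier c)).trans
      (congrArg (Ideal.Quotient.mk G.vanishingIdeal)
        ((SigmaEnvelope.diffAlg σ A).sigma_algebraMap c))

/-- The projection `k{𝒢} → k{G}`. -/
noncomputable def proj : (SigmaEnvelope.diffAlg σ A).carrier →ₐ[k] G.coordAlg.carrier :=
  Ideal.Quotient.mkₐ k G.vanishingIdeal

theorem proj_surjective : Function.Surjective G.proj := Ideal.Quotient.mk_surjective

theorem proj_eq_zero_iff {f : (SigmaEnvelope.diffAlg σ A).carrier} :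
    G.proj f = 0 ↔ f ∈ G.vanishingIdeal := Ideal.Quotient.eq_zero_iff_mem

theorem sigmaCompat_proj : SigmaCompat G.proj := fun _ ↦ rfl

/-- The generic point of `G`, with values in `k{G}`. -/
noncomputable def genericPoint : A →ₐ[k] G.coordAlg.carrier :=
  G.proj.comp (SigmaEnvelope.incl σ A)

theorem iterate_sigma_genericPoint (i : ℕ) (a : A) :
    G.coordAlg.sigma^[i] (G.genericPoint a) = G.proj (SigmaEnvelope.gen σ A i a) := by
  rw [← SigmaEnvelope.iterate_sigma_incl]
  exact ((Function.Semiconj.iterate_right (f := G.proj) G.sigmaCompat_proj i) _).symm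

theorem eval_comp_genericPoint {R : DiffAlg σ} {φ : G.coordAlg.carrier →ₐ[k] R.carrier}
    (hφ : SigmaCompat φ) : SigmaEnvelope.eval (φ.comp G.genericPoint) = φ.comp G.proj := by
  refine SigmaEnvelope.algHom_ext_gen fun i a ↦ ?_
  rw [SigmaEnvelope.eval_gen, AlgHom.comp_apply, AlgHom.comp_apply,
    ← iterate_sigma_genericPoint]
  exact ((Function.Semiconj.iterate_right (f := φ) hφ i) _).symm

theorem comp_genericPoint_mem {R : DiffAlg σ} {φ : G.coordAlg.carrier →ₐ[k] R.carrier}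
    (hφ : SigmaCompat φ) : toConv (φ.comp G.genericPoint) ∈ G.points R := by
  refine G.mem_points_iff.2 fun f hf ↦ ?_
  rw [G.eval_comp_genericPoint hφ, AlgHom.comp_apply, G.proj_eq_zero_iff.2 hf, map_zero]

theorem genericPoint_mem : toConv G.genericPoint ∈ G.points G.coordAlg :=
  G.comp_genericPoint_mem (SigmaCompat.id _)

/-- `k{G}` is generated by the generic point and its transforms under `σ`. -/
theorem algHom_ext_genericPoint {R : DiffAlg σ} {φ ψ : G.coordAlg.carrier →ₐ[k] R.carrier}
    (hφ : SigmaCompat φ) (hψ : SigmaCompat ψ)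
    (h : φ.comp G.genericPoint = ψ.comp G.genericPoint) : φ = ψ := by
  refine AlgHom.ext fun b ↦ ?_
  obtain ⟨f, rfl⟩ := G.proj_surjective b
  rw [← AlgHom.comp_apply, ← AlgHom.comp_apply, ← G.eval_comp_genericPoint hφ,
    ← G.eval_comp_genericPoint hψ, h]

/-- The morphism `k{G} → R` corresponding to a point of `G` with values in `R`. -/
noncomputable def desc {R : DiffAlg σ} (g : A →ₐ[k] R.carrier) (hg : toConv g ∈ G.points R) :
    G.coordAlg.carrier →ₐ[k] R.carrier :=
  Ideal.Quotient.liftₐ G.vanishingIdeal (SigmaEnvelope.eval g) (G.mem_points_iff.1 hg)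

theorem desc_proj {R : DiffAlg σ} (g : A →ₐ[k] R.carrier) (hg : toConv g ∈ G.points R)
    (f : (SigmaEnvelope.diffAlg σ A).carrier) :
    G.desc g hg (G.proj f) = SigmaEnvelope.eval g f := rfl

theorem sigmaCompat_desc {R : DiffAlg σ} (g : A →ₐ[k] R.carrier) (hg : toConv g ∈ G.points R) :
    SigmaCompat (G.desc g hg) := fun b ↦ by
  obtain ⟨f, rfl⟩ := G.proj_surjective b
  rw [← G.sigmaCompat_proj, desc_proj, desc_proj, SigmaEnvelope.eval_sigma]

theorem desc_comp_genericPoint {R : DiffAlg σ} (g : A →ₐ[k] R.carrier)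
    (hg : toConv g ∈ G.points R) : (G.desc g hg).comp G.genericPoint = g :=
  AlgHom.ext fun a ↦ SigmaEnvelope.eval_gen g 0 a

end SigmaClosedSubgroup

/-! ### The Hopf algebra structure of the coordinate ring -/

namespace SigmaClosedSubgroup

open TensorProduct WithConv DiffAlg

variable {k : Type u} [Field k] {σ : k →+* k} {A : Type u} [CommRing A] [HopfAlgebra k A]
  (G : SigmaClosedSubgroup σ A)

/-- The comultiplication of `k{G}`: the product of the two generic points of `G` with values in
`k{G} ⊗ k{G}`. -/
noncomputable def comul : G.coordAlg.carrier →ₐ[k] (tensor G.coordAlg G.coordAlg).carrier :=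
  G.desc (R := tensor G.coordAlg G.coordAlg)
    (toConv (Algebra.TensorProduct.includeLeft.comp G.genericPoint) *
      toConv (Algebra.TensorProduct.includeRight.comp G.genericPoint)).ofConv
    (mul_mem (G.comp_genericPoint_mem (SigmaCompat.includeLeft G.coordAlg G.coordAlg))
      (G.comp_genericPoint_mem (SigmaCompat.includeRight G.coordAlg G.coordAlg)))

/-- The counit of `k{G}`: the neutral element of `G(k)`. -/
noncomputable def counit : G.coordAlg.carrier →ₐ[k] (base σ).carrier :=
  G.desc (R := base σ) (1 : WithConv (A →ₐ[k] k)).ofConv (G.points (base σ)).one_mem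

/-- The antipode of `k{G}`: the inverse of the generic point. -/
noncomputable def antipode : G.coordAlg.carrier →ₐ[k] G.coordAlg.carrier :=
  G.desc (G.genericPoint.comp (HopfAlgebra.antipodeAlgHom k A))
    ((G.points G.coordAlg).inv_mem G.genericPoint_mem)

theorem sigmaCompat_comul : SigmaCompat G.comul := G.sigmaCompat_desc _ _

theorem sigmaCompat_counit : SigmaCompat G.counit := G.sigmaCompat_desc _ _

theorem sigmaCompat_antipode : SigmaCompat G.antipode := G.sigmaCompat_desc _ _

theorem comul_comp_genericPoint :
    G.comul.comp G.genericPoint =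
      (Algebra.TensorProduct.map G.genericPoint G.genericPoint).comp
        (Bialgebra.comulAlgHom k A) := by
  refine (G.desc_comp_genericPoint _ _).trans (AlgHom.ext fun a ↦ ?_)
  refine (AlgHom.convMul_apply _ _ a).trans ?_
  refine DFunLike.congr_fun (f := Algebra.TensorProduct.lift _ _ _)
    (g := Algebra.TensorProduct.map G.genericPoint G.genericPoint) ?_ _
  ext <;> simp

theorem counit_comp_genericPoint :
    G.counit.comp G.genericPoint = Bialgebra.counitAlgHom k A :=
  (G.desc_comp_genericPoint _ _).trans (AlgHom.ext fun _ ↦ rfl)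

theorem antipode_comp_genericPoint :
    G.antipode.comp G.genericPoint = G.genericPoint.comp (HopfAlgebra.antipodeAlgHom k A) :=
  G.desc_comp_genericPoint _ _

theorem assoc_comp_map_comul_comp_comul :
    (Algebra.TensorProduct.assoc k k k G.coordAlg.carrier G.coordAlg.carrier
      G.coordAlg.carrier).toAlgHom.comp
      ((Algebra.TensorProduct.map G.comul (.id k G.coordAlg.carrier)).comp G.comul) =
    (Algebra.TensorProduct.map (.id k G.coordAlg.carrier) G.comul).comp G.comul := by
  let B := G.coordAlg
  let u := G.genericPoint
  let Δ := Bialgebra.comulAlgHom k A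
  have hu : G.comul.comp u = (Algebra.TensorProduct.map u u).comp Δ := G.comul_comp_genericPoint
  refine G.algHom_ext_genericPoint (R := tensor B (tensor B B))
    ((SigmaCompat.assoc B B B).comp (((G.sigmaCompat_comul.map (SigmaCompat.id B)).comp
      G.sigmaCompat_comul)))
    (((SigmaCompat.id B).map G.sigmaCompat_comul).comp G.sigmaCompat_comul) ?_
  have h1 : (Algebra.TensorProduct.map G.comul (.id k B.carrier)).comp
      (Algebra.TensorProduct.map u u) =
      (Algebra.TensorProduct.map (Algebra.TensorProduct.map u u) u).comp
        (Algebra.TensorProduct.map Δ (.id k A)) := by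
    rw [← Algebra.TensorProduct.map_comp, hu, ← Algebra.TensorProduct.map_comp]
    rfl
  have h2 : (Algebra.TensorProduct.map (.id k B.carrier) G.comul).comp
      (Algebra.TensorProduct.map u u) =
      (Algebra.TensorProduct.map u (Algebra.TensorProduct.map u u)).comp
        (Algebra.TensorProduct.map (.id k A) Δ) := by
    rw [← Algebra.TensorProduct.map_comp, hu, ← Algebra.TensorProduct.map_comp]
    rfl
  have h3 : (Algebra.TensorProduct.assoc k k k B.carrier B.carrier B.carrier).toAlgHom.comp
      (Algebra.TensorProduct.map (Algebra.TensorProduct.map u u) u) =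
      (Algebra.TensorProduct.map u (Algebra.TensorProduct.map u u)).comp
        (Algebra.TensorProduct.assoc k k k A A A).toAlgHom := by
    ext <;> simp [Algebra.TensorProduct.one_def]
  calc ((Algebra.TensorProduct.assoc k k k B.carrier B.carrier B.carrier).toAlgHom.comp
        ((Algebra.TensorProduct.map G.comul (.id k B.carrier)).comp G.comul)).comp u
      = (Algebra.TensorProduct.assoc k k k B.carrier B.carrier B.carrier).toAlgHom.comp
          (((Algebra.TensorProduct.map G.comul (.id k B.carrier)).comp
            (Algebra.TensorProduct.map u u)).comp Δ) := by
        rw [AlgHom.comp_assoc, AlgHom.comp_assoc, hu, AlgHom.comp_assoc]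
    _ = ((Algebra.TensorProduct.assoc k k k B.carrier B.carrier B.carrier).toAlgHom.comp
          (Algebra.TensorProduct.map (Algebra.TensorProduct.map u u) u)).comp
            ((Algebra.TensorProduct.map Δ (.id k A)).comp Δ) := by
        rw [h1, AlgHom.comp_assoc, AlgHom.comp_assoc]
    _ = (Algebra.TensorProduct.map u (Algebra.TensorProduct.map u u)).comp
          ((Algebra.TensorProduct.map (.id k A) Δ).comp Δ) := by
        rw [h3, ← Bialgebra.assoc_comp_map_comul_comp_comul, AlgHom.comp_assoc]
    _ = ((Algebra.TensorProduct.map (.id k B.carrier) G.comul).comp G.comul).comp u := by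
        rw [← AlgHom.comp_assoc, ← h2, AlgHom.comp_assoc, AlgHom.comp_assoc, hu]

theorem map_counit_id_comp_comul :
    (Algebra.TensorProduct.map G.counit (.id k G.coordAlg.carrier)).comp G.comul =
      (Algebra.TensorProduct.lid k G.coordAlg.carrier).symm := by
  let B := G.coordAlg
  let u := G.genericPoint
  refine G.algHom_ext_genericPoint (R := tensor (base σ) B)
    ((G.sigmaCompat_counit.map (SigmaCompat.id B)).comp G.sigmaCompat_comul)
    (SigmaCompat.lid_symm B) ?_
  have h1 : (Algebra.TensorProduct.map G.counit (.id k B.carrier)).comp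
      (Algebra.TensorProduct.map u u) = (Algebra.TensorProduct.map (.id k k) u).comp
        (Algebra.TensorProduct.map (Bialgebra.counitAlgHom k A) (.id k A)) := by
    rw [← Algebra.TensorProduct.map_comp, counit_comp_genericPoint,
      ← Algebra.TensorProduct.map_comp]
    rfl
  have h2 : (Algebra.TensorProduct.map (.id k k) u).comp
      ((Algebra.TensorProduct.lid k A).symm : A →ₐ[k] k ⊗[k] A) =
      ((Algebra.TensorProduct.lid k B.carrier).symm : B.carrier →ₐ[k] k ⊗[k] B.carrier).comp u := by
    ext; simp
  refine Eq.trans ?_ h2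
  rw [← Bialgebra.map_counit_id_comp_comul, ← AlgHom.comp_assoc, ← h1, AlgHom.comp_assoc,
    AlgHom.comp_assoc, comul_comp_genericPoint]

theorem map_id_counit_comp_comul :
    (Algebra.TensorProduct.map (.id k G.coordAlg.carrier) G.counit).comp G.comul =
      (Algebra.TensorProduct.rid k k G.coordAlg.carrier).symm := by
  let B := G.coordAlg
  let u := G.genericPoint
  refine G.algHom_ext_genericPoint (R := tensor B (base σ))
    (((SigmaCompat.id B).map G.sigmaCompat_counit).comp G.sigmaCompat_comul)
    (SigmaCompat.rid_symm B) ?_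
  have h1 : (Algebra.TensorProduct.map (.id k B.carrier) G.counit).comp
      (Algebra.TensorProduct.map u u) = (Algebra.TensorProduct.map u (.id k k)).comp
        (Algebra.TensorProduct.map (.id k A) (Bialgebra.counitAlgHom k A)) := by
    rw [← Algebra.TensorProduct.map_comp, counit_comp_genericPoint,
      ← Algebra.TensorProduct.map_comp]
    rfl
  have h2 : (Algebra.TensorProduct.map u (.id k k)).comp
      ((Algebra.TensorProduct.rid k k A).symm : A →ₐ[k] A ⊗[k] k) =
      ((Algebra.TensorProduct.rid k k B.carrier).symm :
        B.carrier →ₐ[k] B.carrier ⊗[k] k).comp u := by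
    ext; simp
  refine Eq.trans ?_ h2
  rw [← Bialgebra.map_id_counit_comp_comul, ← AlgHom.comp_assoc, ← h1, AlgHom.comp_assoc,
    AlgHom.comp_assoc, comul_comp_genericPoint]

theorem lift_antipode_id_comp_comul :
    (Algebra.TensorProduct.lift G.antipode (.id k G.coordAlg.carrier) fun _ _ ↦ .all _ _).comp
      G.comul = (Algebra.ofId k G.coordAlg.carrier).comp G.counit := by
  let B := G.coordAlg
  let u := G.genericPoint
  refine G.algHom_ext_genericPoint (R := B)
    ((G.sigmaCompat_antipode.lift (SigmaCompat.id B)).comp G.sigmaCompat_comul)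
    ((SigmaCompat.ofId B).comp G.sigmaCompat_counit) ?_
  have h1 : (Algebra.TensorProduct.lift G.antipode (.id k B.carrier) fun _ _ ↦ .all _ _).comp
      (Algebra.TensorProduct.map u u) = u.comp (Algebra.TensorProduct.lift
        (HopfAlgebra.antipodeAlgHom k A) (.id k A) fun _ _ ↦ .all _ _) := by
    ext a
    · simpa [u] using DFunLike.congr_fun G.antipode_comp_genericPoint a
    · simp
  rw [AlgHom.comp_assoc, comul_comp_genericPoint, ← AlgHom.comp_assoc, h1, AlgHom.comp_assoc,
    AlgHom.comp_assoc, counit_comp_genericPoint]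
  refine AlgHom.ext fun a ↦ ?_
  exact (congrArg u (Bialgebra.lift_antipode_id_comul a)).trans (u.commutes _)

theorem lift_id_antipode_comp_comul :
    (Algebra.TensorProduct.lift (.id k G.coordAlg.carrier) G.antipode fun _ _ ↦ .all _ _).comp
      G.comul = (Algebra.ofId k G.coordAlg.carrier).comp G.counit := by
  let B := G.coordAlg
  let u := G.genericPoint
  refine G.algHom_ext_genericPoint (R := B)
    (((SigmaCompat.id B).lift G.sigmaCompat_antipode).comp G.sigmaCompat_comul)
    ((SigmaCompat.ofId B).comp G.sigmaCompat_counit) ?_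
  have h1 : (Algebra.TensorProduct.lift (.id k B.carrier) G.antipode fun _ _ ↦ .all _ _).comp
      (Algebra.TensorProduct.map u u) = u.comp (Algebra.TensorProduct.lift
        (.id k A) (HopfAlgebra.antipodeAlgHom k A) fun _ _ ↦ .all _ _) := by
    ext a
    · simp
    · simpa [u] using DFunLike.congr_fun G.antipode_comp_genericPoint a
  rw [AlgHom.comp_assoc, comul_comp_genericPoint, ← AlgHom.comp_assoc, h1, AlgHom.comp_assoc,
    AlgHom.comp_assoc, counit_comp_genericPoint]
  refine AlgHom.ext fun a ↦ ?_
  exact (congrArg u (Bialgebra.lift_id_antipode_comul a)).trans (u.commutes _)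

/-- The bialgebra structure of `k{G}`. -/
noncomputable abbrev bialgebra : Bialgebra k G.coordAlg.carrier :=
  Bialgebra.ofAlgHom G.comul G.counit G.assoc_comp_map_comul_comp_comul G.map_counit_id_comp_comul
    G.map_id_counit_comp_comul

/-- The Hopf algebra structure of `k{G}`. -/
noncomputable abbrev hopfAlgebra : HopfAlgebra k G.coordAlg.carrier :=
  letI := G.bialgebra
  HopfAlgebra.ofAlgHom G.antipode G.lift_antipode_id_comp_comul G.lift_id_antipode_comp_comul

/-- Comultiplication, counit and antipode are morphisms of `k`-`σ`-algebras, being induced by points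
of `G` in `k`-`σ`-algebras. -/
theorem isSemilinearHopfEndomorphism_sigma :
    letI := G.hopfAlgebra
    IsSemilinearHopfEndomorphism σ G.coordAlg.sigma :=
  letI := G.hopfAlgebra
  { map_algebraMap := G.coordAlg.sigma_algebraMap
    map_counit := G.sigmaCompat_counit
    map_antipode := G.sigmaCompat_antipode
    exists_map_comul := ⟨(tensor G.coordAlg G.coordAlg).sigma,
      tensor_sigma_tmul G.coordAlg G.coordAlg, G.sigmaCompat_comul⟩ }

/-- The image of `k[𝒢]` in `k{G}`, the coordinate ring of the Zariski closure `G[0]`. -/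
noncomputable abbrev orderZero : Subalgebra k G.coordAlg.carrier := G.genericPoint.range

theorem isComulStable_orderZero :
    letI := G.hopfAlgebra
    IsComulStable k G.orderZero G.coordAlg.carrier := by
  have h1 : (Algebra.TensorProduct.map G.orderZero.val G.orderZero.val).comp
      (Algebra.TensorProduct.map G.genericPoint.rangeRestrict G.genericPoint.rangeRestrict) =
      Algebra.TensorProduct.map G.genericPoint G.genericPoint := by
    rw [← Algebra.TensorProduct.map_comp]; rfl
  rintro ⟨_, a, rfl⟩
  refine ⟨Algebra.TensorProduct.map G.genericPoint.rangeRestrict G.genericPoint.rangeRestrict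
    (Bialgebra.comulAlgHom k A a), ?_⟩
  exact (DFunLike.congr_fun h1 _).trans (DFunLike.congr_fun G.comul_comp_genericPoint a).symm

theorem antipode_mem_orderZero : ∀ b ∈ G.orderZero, G.antipode b ∈ G.orderZero := by
  rintro _ ⟨a, rfl⟩
  exact ⟨HopfAlgebra.antipodeAlgHom k A a,
    (DFunLike.congr_fun G.antipode_comp_genericPoint a).symm⟩

theorem orderZero_fg [Algebra.FiniteType k A] : G.orderZero.FG :=
  (Subalgebra.fg_iff_finiteType _).2
    (Algebra.FiniteType.of_surjective G.genericPoint.rangeRestrict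
      G.genericPoint.rangeRestrict_surjective)

/-- The coordinate ring of the Zariski closure `G[i]`, as a subalgebra of `k{G}`. -/
noncomputable def order (i : ℕ) : Subalgebra k G.coordAlg.carrier :=
  iterateAdjoin G.coordAlg.sigma G.orderZero (i + 1)

theorem map_proj_orderLE (i : ℕ) : (SigmaEnvelope.orderLE σ A i).map G.proj = G.order i := by
  rw [SigmaEnvelope.orderLE, AlgHom.map_adjoin, order, iterateAdjoin]
  congr 1
  ext b
  constructor
  · rintro ⟨_, ⟨j, hj, a, rfl⟩, rfl⟩
    exact ⟨j, Nat.lt_succ_of_le hj, _, ⟨a, rfl⟩, (G.iterate_sigma_genericPoint j a).symm⟩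
  · rintro ⟨j, hj, _, ⟨a, rfl⟩, rfl⟩
    exact ⟨_, ⟨j, Nat.le_of_lt_succ hj, a, rfl⟩, (G.iterate_sigma_genericPoint j a).symm⟩

theorem zariskiClosureDim_eq_ringKrullDim (i : ℕ) :
    G.zariskiClosureDim i = ringKrullDim (G.order i) := by
  let φ : SigmaEnvelope.orderLE σ A i →ₐ[k] G.coordAlg.carrier :=
    G.proj.comp (SigmaEnvelope.orderLE σ A i).val
  have hrange : φ.range = G.order i := by
    rw [← map_proj_orderLE, AlgHom.range_comp, Subalgebra.range_val]
  have hker : RingHom.ker φ.rangeRestrict =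
      G.vanishingIdeal.comap (SigmaEnvelope.orderLE σ A i).val := by
    ext f
    rw [RingHom.mem_ker, Ideal.mem_comap, ← G.proj_eq_zero_iff]
    exact Subtype.ext_iff
  rw [zariskiClosureDim, ← hrange]
  exact ringKrullDim_eq_of_ringEquiv ((Ideal.quotEquivOfEq hker.symm).trans
    (Ideal.quotientKerAlgEquivOfSurjective φ.rangeRestrict_surjective).toRingEquiv)

instance : Nontrivial G.coordAlg.carrier := G.counit.toRingHom.domain_nontrivial

theorem finiteType_order [Algebra.FiniteType k A] (i : ℕ) : Algebra.FiniteType k (G.order i) :=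
  (Subalgebra.fg_iff_finiteType _).1
    (iterateAdjoin_fg G.coordAlg.sigma_algebraMap G.orderZero_fg (i + 1))

theorem zariskiClosureDim_eq_trdeg [Algebra.FiniteType k A] (i : ℕ) :
    G.zariskiClosureDim i = ((Cardinal.toNat (Algebra.trdeg k (G.order i)) : ℕ) : WithBot ℕ∞) :=
  have := G.finiteType_order i
  (G.zariskiClosureDim_eq_ringKrullDim i).trans (ringKrullDim_eq_toNat_trdeg k _)

/-- The dimensions of the Zariski closures grow eventually linearly. -/
theorem exists_zariskiClosureDim_eq [Algebra.FiniteType k A] :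
    ∃ d e : ℕ, ∀ᶠ i : ℕ in Filter.atTop,
      G.zariskiClosureDim i = ((d * (i + 1) + e : ℕ) : WithBot ℕ∞) := by
  obtain ⟨d, e, h⟩ :=
    letI := G.hopfAlgebra
    exists_trdeg_iterateAdjoin_eq G.isSemilinearHopfEndomorphism_sigma G.orderZero_fg
      G.isComulStable_orderZero G.antipode_mem_orderZero
  refine ⟨d, e, h.mono fun i hi ↦ ?_⟩
  rw [zariskiClosureDim_eq_trdeg, ← hi]
  rfl

end SigmaClosedSubgroup

/-! ### Independence of the embedding -/

namespace SigmaClosedSubgroup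

open WithConv DiffAlg

variable {k : Type u} [Field k] {σ : k →+* k}

section Embedding

variable {A : Type u} [CommRing A] [HopfAlgebra k A] {A' : Type u} [CommRing A'] [HopfAlgebra k A']

/-- Two `σ`-closed subgroups that are images of embeddings of the same group functor have
isomorphic coordinate rings. The morphisms correspond to the generic points, transported through
the functor; only a left inverse is recorded. -/
theorem exists_injective_of_isSigmaClosedEmbeddingOnto {G : DiffAlg σ ⥤ GrpCat.{u}}
    {φ : G ⟶ sigmaPoints σ A} {H : SigmaClosedSubgroup σ A} {φ' : G ⟶ sigmaPoints σ A'}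
    {H' : SigmaClosedSubgroup σ A'} (h : IsSigmaClosedEmbeddingOnto φ H)
    (h' : IsSigmaClosedEmbeddingOnto φ' H') :
    ∃ ψ : H'.coordAlg.carrier →ₐ[k] H.coordAlg.carrier,
      SigmaCompat ψ ∧ Function.Injective ψ := by
  have hx : toConv H.genericPoint ∈ (φ.app H.coordAlg).hom.range :=
    (h H.coordAlg).2 ▸ H.genericPoint_mem
  have hx' : toConv H'.genericPoint ∈ (φ'.app H'.coordAlg).hom.range :=
    (h' H'.coordAlg).2 ▸ H'.genericPoint_mem
  obtain ⟨x, hx⟩ := hx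
  obtain ⟨x', hx'⟩ := hx'
  let g' : WithConv (A' →ₐ[k] H.coordAlg.carrier) := (φ'.app H.coordAlg).hom x
  have hg' : g' ∈ H'.points H.coordAlg := (h' H.coordAlg).2 ▸ ⟨x, rfl⟩
  let g : WithConv (A →ₐ[k] H'.coordAlg.carrier) := (φ.app H'.coordAlg).hom x'
  have hg : g ∈ H.points H'.coordAlg := (h H'.coordAlg).2 ▸ ⟨x', rfl⟩
  let ψ' := H'.desc g'.ofConv hg'
  let ψ := H.desc g.ofConv hg
  let ψσ : H.coordAlg ⟶ H'.coordAlg := ⟨ψ, H.sigmaCompat_desc _ _⟩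
  -- Both points have the same image under `φ`, because `ψ` maps the generic point of `H` to `g`.
  have hxx' : (G.map ψσ).hom x = x' := by
    refine (h H'.coordAlg).1 ?_
    have hnat : (φ.app H'.coordAlg).hom ((G.map ψσ).hom x) =
        ((sigmaPoints σ A).map ψσ).hom ((φ.app H.coordAlg).hom x) :=
      congrArg (fun f ↦ f.hom x) (φ.naturality ψσ)
    rw [hnat, hx]
    exact congrArg toConv (H.desc_comp_genericPoint g.ofConv hg)
  have hinv : ψ.comp ψ' = AlgHom.id k _ := by
    refine H'.algHom_ext_genericPoint ((H.sigmaCompat_desc _ _).comp (H'.sigmaCompat_desc _ _))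
      (SigmaCompat.id _) ?_
    have hψ' : ψ'.comp H'.genericPoint = g'.ofConv := H'.desc_comp_genericPoint _ hg'
    rw [AlgHom.comp_assoc, hψ', AlgHom.id_comp]
    have hnat : (φ'.app H'.coordAlg).hom ((G.map ψσ).hom x) =
        ((sigmaPoints σ A').map ψσ).hom ((φ'.app H.coordAlg).hom x) :=
      congrArg (fun f ↦ f.hom x) (φ'.naturality ψσ)
    rw [hxx', hx'] at hnat
    exact congrArg ofConv hnat.symm
  exact ⟨ψ', H'.sigmaCompat_desc _ _,
    Function.LeftInverse.injective (g := ψ) fun b ↦ DFunLike.congr_fun hinv b⟩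

theorem order_mono (H : SigmaClosedSubgroup σ A) : Monotone H.order := fun _ _ h ↦
  iterateAdjoin_mono _ (Nat.succ_le_succ h)

theorem exists_mem_order (H : SigmaClosedSubgroup σ A) (b : H.coordAlg.carrier) :
    ∃ m, b ∈ H.order m := by
  obtain ⟨f, rfl⟩ := H.proj_surjective b
  obtain ⟨p, rfl⟩ := Ideal.Quotient.mk_surjective f
  let π := H.proj.comp (Ideal.Quotient.mkₐ k (Ideal.span (SigmaEnvelope.relations σ A)))
  change ∃ m, π p ∈ H.order m
  induction p using MvPolynomial.induction_on with
  | C c =>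
    refine ⟨0, ?_⟩
    rw [show π (MvPolynomial.C c) = algebraMap k _ c from π.commutes c]
    exact Subalgebra.algebraMap_mem _ c
  | add p q hp hq =>
    obtain ⟨m, hm⟩ := hp
    obtain ⟨n, hn⟩ := hq
    refine ⟨max m n, ?_⟩
    rw [map_add]
    exact add_mem (H.order_mono (le_max_left m n) hm) (H.order_mono (le_max_right m n) hn)
  | mul_X p a hp =>
    obtain ⟨m, hm⟩ := hp
    refine ⟨max m a.1, ?_⟩
    rw [map_mul]
    refine mul_mem (H.order_mono (le_max_left m a.1) hm)
      (H.order_mono (le_max_right m a.1) ?_)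
    rw [← map_proj_orderLE]
    exact ⟨SigmaEnvelope.gen σ A a.1 a.2, Algebra.subset_adjoin ⟨a.1, le_rfl, a.2, rfl⟩, rfl⟩

/-- A morphism between the coordinate rings raises the order by at most a constant. -/
theorem exists_order_le_comap [Algebra.FiniteType k A'] {H : SigmaClosedSubgroup σ A}
    {H' : SigmaClosedSubgroup σ A'} {ψ : H'.coordAlg.carrier →ₐ[k] H.coordAlg.carrier}
    (hψ : SigmaCompat ψ) : ∃ m, ∀ i, H'.order i ≤ (H.order (i + m)).comap ψ := by
  obtain ⟨S, hS⟩ := H'.orderZero_fg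
  choose m hm using fun b ↦ H.exists_mem_order (ψ b)
  have hV : H'.orderZero ≤ (H.order (S.sup m)).comap ψ := by
    rw [← hS]
    exact Algebra.adjoin_le fun b hb ↦ H.order_mono (Finset.le_sup hb) (hm b)
  have hiter (v : H'.coordAlg.carrier) (hv : v ∈ H'.orderZero) (j : ℕ) :
      ψ (H'.coordAlg.sigma^[j] v) ∈ H.order (j + S.sup m) := by
    induction j with
    | zero => rw [zero_add]; exact hV hv
    | succ j ih =>
      rw [Function.iterate_succ_apply', hψ, Nat.succ_add]
      exact apply_mem_iterateAdjoin_succ H.coordAlg.sigma_algebraMap ih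
  refine ⟨S.sup m, fun i ↦ Algebra.adjoin_le ?_⟩
  rintro _ ⟨j, hj, v, hv, rfl⟩
  exact H.order_mono (Nat.add_le_add_right (Nat.le_of_lt_succ hj) _) (hiter v hv j)

/-- An injective morphism `k{G'} → k{G}` of coordinate rings bounds the dimensions of `G'` by those
of `G`, up to a shift of the order. -/
theorem exists_trdeg_order_le [Algebra.FiniteType k A] [Algebra.FiniteType k A']
    {H : SigmaClosedSubgroup σ A} {H' : SigmaClosedSubgroup σ A'}
    {ψ : H'.coordAlg.carrier →ₐ[k] H.coordAlg.carrier} (hψ : SigmaCompat ψ)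
    (hinj : Function.Injective ψ) :
    ∃ m, ∀ i, Cardinal.toNat (Algebra.trdeg k (H'.order i)) ≤
      Cardinal.toNat (Algebra.trdeg k (H.order (i + m))) := by
  obtain ⟨m, hm⟩ := exists_order_le_comap hψ
  refine ⟨m, fun i ↦ ?_⟩
  have := H.finiteType_order (i + m)
  refine Cardinal.toNat_le_toNat ?_ trdeg_lt_aleph0_of_finiteType
  exact trdeg_le_of_injective
    ((ψ.comp (H'.order i).val).codRestrict (H.order (i + m)) fun b ↦ hm i b.2)
    fun a b hab ↦ Subtype.ext (hinj (congrArg Subtype.val hab))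

/-- One half of the independence of the embedding. The shift of the order by `m` adds `d * m` to the
bound, which does not affect the leading coefficient and vanishes for `d = 0`. -/
theorem le_and_le_of_isSigmaClosedEmbeddingOnto [Algebra.FiniteType k A] [Algebra.FiniteType k A']
    {G : DiffAlg σ ⥤ GrpCat.{u}}
    {φ : G ⟶ sigmaPoints σ A} {H : SigmaClosedSubgroup σ A} {φ' : G ⟶ sigmaPoints σ A'}
    {H' : SigmaClosedSubgroup σ A'} (h : IsSigmaClosedEmbeddingOnto φ H)
    (h' : IsSigmaClosedEmbeddingOnto φ' H') {d e d' e' : ℕ}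
    (hd : ∀ᶠ i : ℕ in Filter.atTop,
      H.zariskiClosureDim i = ((d * (i + 1) + e : ℕ) : WithBot ℕ∞))
    (hd' : ∀ᶠ i : ℕ in Filter.atTop,
      H'.zariskiClosureDim i = ((d' * (i + 1) + e' : ℕ) : WithBot ℕ∞)) :
    d' ≤ d ∧ (d = 0 → e' ≤ e) := by
  obtain ⟨ψ, hψ, hinj⟩ := exists_injective_of_isSigmaClosedEmbeddingOnto h h'
  obtain ⟨m, hm⟩ := exists_trdeg_order_le hψ hinj
  obtain ⟨N, hN⟩ := Filter.eventually_atTop.1 hd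
  obtain ⟨N', hN'⟩ := Filter.eventually_atTop.1 hd'
  have key : ∀ i, N ≤ i → N' ≤ i → d' * (i + 1) + e' ≤ d * (i + m + 1) + e := by
    intro i hi hi'
    have h1 := hN (i + m) (by omega)
    have h2 := hN' i hi'
    rw [zariskiClosureDim_eq_trdeg] at h1 h2
    have h1' := Nat.cast_injective (R := WithBot ℕ∞) h1
    have h2' := Nat.cast_injective (R := WithBot ℕ∞) h2
    rw [← h1', ← h2']
    exact hm i
  have hle : d' ≤ d := by
    by_contra! hlt
    -- The inequality `key` fails at any index that exceeds `d * m + e`.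
    have h1 := key (N + N' + d * m + e) (by omega) (by omega)
    have h2 : (d + 1) * (N + N' + d * m + e + 1) ≤ d' * (N + N' + d * m + e + 1) :=
      Nat.mul_le_mul_right _ hlt
    nlinarith
  refine ⟨hle, fun h0 ↦ ?_⟩
  subst h0
  obtain rfl : d' = 0 := Nat.le_zero.1 hle
  simpa using key (N + N') (by omega) (by omega)

end Embedding

end SigmaClosedSubgroup

theorem mainTheorem4 {k : Type u} [Field k] (σ : k →+* k) :
    -- Existence of `d` and `e`, for every `σ`-closed subgroup of an algebraic group.
    (∀ (A : Type u) [CommRing A] [HopfAlgebra k A] [Algebra.FiniteType k A]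
      (G : SigmaClosedSubgroup σ A),
      ∃ d e : ℕ, ∀ᶠ i : ℕ in Filter.atTop,
        G.zariskiClosureDim i = ((d * (i + 1) + e : ℕ) : WithBot ℕ∞)) ∧
    -- Independence of the embedding of a `σ`-algebraic group `G` into an algebraic group.
    (∀ G : DiffAlg σ ⥤ GrpCat.{u}, IsSigmaAlgebraicGroup G →
      ∀ (A : Type u) [CommRing A] [HopfAlgebra k A] [Algebra.FiniteType k A]
        (A' : Type u) [CommRing A'] [HopfAlgebra k A'] [Algebra.FiniteType k A']
        (φ : G ⟶ sigmaPoints σ A) (H : SigmaClosedSubgroup σ A)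
        (φ' : G ⟶ sigmaPoints σ A') (H' : SigmaClosedSubgroup σ A'),
        IsSigmaClosedEmbeddingOnto φ H → IsSigmaClosedEmbeddingOnto φ' H' →
        ∀ d e d' e' : ℕ,
          (∀ᶠ i : ℕ in Filter.atTop,
            H.zariskiClosureDim i = ((d * (i + 1) + e : ℕ) : WithBot ℕ∞)) →
          (∀ᶠ i : ℕ in Filter.atTop,
            H'.zariskiClosureDim i = ((d' * (i + 1) + e' : ℕ) : WithBot ℕ∞)) →
          d = d' ∧ (d = 0 → e = e')) := by
  refine ⟨fun A _ _ _ G ↦ G.exists_zariskiClosureDim_eq, ?_⟩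
  intro G _ A _ _ _ A' _ _ _ φ H φ' H' h h' d e d' e' hd hd'
  obtain ⟨h1, h2⟩ := SigmaClosedSubgroup.le_and_le_of_isSigmaClosedEmbeddingOnto h h' hd hd'
  obtain ⟨h3, h4⟩ := SigmaClosedSubgroup.le_and_le_of_isSigmaClosedEmbeddingOnto h' h hd' hd
  obtain rfl : d = d' := le_antisymm h3 h1
  exact ⟨rfl, fun h0 ↦ le_antisymm (h4 h0) (h2 h0)⟩
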